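/- **Notation.** For $x\in\mathbb R^3$ let $B(x,r)$ be the closed ball. For $\varepsilon>0$ a function $\ell:\mathbb R^3\to(0,\infty)$ is called $\varepsilon$-*tempered* if $|x-y|\le\varepsilon^{-1}\ell(x)$ implies $\tfrac12\le \ell(y)/\ell(x)\le 2$. A countable family of points $(x_i)_{i\in I}$ in $\mathbb R^3$ is called $\ell$-*uniform with intersection constant* $N$ if the balls $B(x_i,\ell_i/10)$, $\ell_i:=\ell(x_i)$, cover $\mathbb R^3$, and every ball $\widetilde D_j:=B(x_j,10\ell_j)$ intersects at most $N$ other balls $\widetilde D_i$. Real smooth functions $\theta_i,\chi_i,\varphi_i$ $(i\in I)$ on $\mathbb R^3$ are called *cutoff functions* for $(x_i)$ with constant $C$ if, for all $i$, * $0\le\theta_i\le1$, $\operatorname{supp}\theta_i\subset B(x_i,\ell_i)$, $\|\nabla\theta_i\|_\infty\le C\ell_i^{-1}$, and $\sum_i\theta_i^2\equiv1$; * $0\le\chi_i\le1$, $\chi_i\equiv1$ on $B(x_i,4\ell_i)$, $\operatorname{supp}\chi_i\subset B(x_i,5\ell_i)$, $\|\nabla\chi_i\|_\infty\le2\ell_i^{-1}$;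 * $\varphi_i\equiv1$ on $B(x_i,4\ell_i)\setminus B(x_i,3\ell_i)$, $\operatorname{supp}\varphi_i\subset B(x_i,5\ell_i)\setminus B(x_i,2\ell_i)$, $\|\nabla\varphi_i\|_\infty\le2\ell_i^{-1}$. A first order operator $A=\mathcal A\cdot\nabla+\mathcal B$ on $L^2(\mathbb R^3;\mathbb C^k)$, where $\mathcal A=(\mathcal A_1,\mathcal A_2,\mathcal A_3)$ and $\mathcal B$ are smooth functions on $\mathbb R^3$ with values in triples of complex $k\times k$ matrices and in complex $k\times k$ matrices, respectively, is understood as the closure of its restriction to smooth compactly supported functions. For $T=A^*A$ and a measurable function $W\ge0$, the operator $T+W$ is the form sum, that is, the operator of the quadratic form $\|Au\|^2+\int W|u|^2$ on $\{u\in D(A):\sqrt W\,u\in L^2\}$. **Proposition 6.1 (Pull-in proposition).** For all $N\in\mathbb N$ and $C\in\mathbb R$ there is a constant $c>0$, and for every $c_0$ there is an $\varepsilon_0>0$ depending only on $c_0,N,C$, such that the following holds for all $0<\varepsilon\le\varepsilon_0$, $\mu\ge0$ and $k\ge1$. Let $\ell$ be a measurable $\varepsilon$-tempered function, let $P(x):=\varepsilon^{-5}\ell(x)^{-2}$,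 and let $F:\mathbb R^3\to(0,\infty)$ be a measurable function with $\tfrac12\le F(x)/F(y)\le2$ whenever $|x-y|\le\varepsilon^{-1}\ell(x)$. Let $A=\mathcal A\cdot\nabla+\mathcal B$ be a first order operator on $L^2(\mathbb R^3;\mathbb C^k)$ with smooth coefficients such that $\sup_x\|\mathcal A(x)\|\le c_0$, where $\|\mathcal A(x)\|:=\max_j\|\mathcal A_j(x)\|$ is the largest of the three operator norms, and let $T=A^*A$. Let $(x_i)_{i\in I}$ be an $\ell$-uniform family of points with intersection constant $N$, let $\theta_i,\chi_i,\varphi_i$ be cutoff functions for it with constant $C$, and for every $i$ let $A_i=\mathcal A_i\cdot\nabla+\mathcal B_i$ be a first order operator with smooth coefficients such that $\mathcal A_i=\mathcal A$ and $\mathcal B_i=\mathcal B$ on $\operatorname{supp}\chi_i$. Put $T_i=A_i^*A_i$, $P_i=P(x_i)$ and $F_i=\sup\{F(x):x\in\widetilde D_i\}$. Then $T+P+\mu$ is self-adjoint and injective, and it maps its domain onto $L^2(\mathbb R^3;\mathbb C^k)$ if $P+\mu$ is bounded below by a positive constant; each $T_i+P_i$ is self-adjoint and maps its domain bijectively onto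 $L^2(\mathbb R^3;\mathbb C^k)$; and $$\frac1{T+P+\mu}F^2\frac1{T+P+\mu}\;\le\; c\sum_{i\in I}F_i^2\,\theta_i^2\Big(P_i^{-1}\frac1{T_i+P_i}A_i^*\varphi_i^2A_i\frac1{T_i+P_i}+\frac1{(T_i+P_i)^2}\Big)\theta_i^2$$ in the sense of quadratic forms: for every $f$ in the domain of $(T+P+\mu)^{-1}$, as an inequality in $[0,\infty]$, $$\int F^2\,\big|(T+P+\mu)^{-1}f\big|^2\;\le\; c\sum_{i\in I}F_i^2\Big(P_i^{-1}\int\varphi_i^2\,\big|A_i(T_i+P_i)^{-1}\theta_i^2f\big|^2+\int\big|(T_i+P_i)^{-1}\theta_i^2f\big|^2\Big).$$ -/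

import Mathlib

open MeasureTheory Metric Set

open scoped ENNReal ContDiff InnerProductSpace

namespace PullIn

/-- Euclidean three-space. -/
abbrev R3 := EuclideanSpace ℝ (Fin 3)

/-- `ℂ^k` with its Hermitian inner product; `Cn k →L[ℂ] Cn k` are the `k × k` matrices with the
operator norm. -/
abbrev Cn (k : ℕ) := EuclideanSpace ℂ (Fin k)

/-- The Hilbert space `L²(ℝ³; ℂ^k)`, i.e. the direct sum of `k` copies of `L²(ℝ³)`. -/
noncomputable abbrev L2 (k : ℕ) := Lp (Cn k) 2 (volume : Measure R3)

/-! ### First order differential operators -/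

/-- A first order differential expression `𝒜 · ∇ + ℬ` with smooth matrix coefficients. -/
structure FirstOrder (k : ℕ) where
  /-- the vector of matrices `𝒜(x) = (𝒜₁(x), 𝒜₂(x), 𝒜₃(x))` -/
  princ : R3 → Fin 3 → (Cn k →L[ℂ] Cn k)
  /-- the matrix `ℬ(x)` -/
  pot : R3 → (Cn k →L[ℂ] Cn k)
  smooth_princ : ContDiff ℝ ∞ princ
  smooth_pot : ContDiff ℝ ∞ pot

namespace FirstOrder

variable {k : ℕ}

/-- The action `ψ ↦ ∑ⱼ 𝒜ⱼ ∂ⱼψ + ℬ ψ` on differentiable functions. -/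
noncomputable def act (a : FirstOrder k) (ψ : R3 → Cn k) (x : R3) : Cn k :=
  ∑ j, a.princ x j (fderiv ℝ ψ x (EuclideanSpace.single j 1)) + a.pot x (ψ x)

theorem act_add (a : FirstOrder k) {ψ η : R3 → Cn k} (hψ : ContDiff ℝ ∞ ψ)
    (hη : ContDiff ℝ ∞ η) : a.act (ψ + η) = a.act ψ + a.act η := by
  funext x
  have h1 : DifferentiableAt ℝ ψ x := (hψ.differentiable (by simp)) x
  have h2 : DifferentiableAt ℝ η x := (hη.differentiable (by simp)) x
  simp only [act, Pi.add_apply, fderiv_add h1 h2, _root_.add_apply, map_add,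
    Finset.sum_add_distrib]
  abel

theorem act_smul (a : FirstOrder k) (z : ℂ) {ψ : R3 → Cn k} (hψ : ContDiff ℝ ∞ ψ) :
    a.act (z • ψ) = z • a.act ψ := by
  funext x
  have h1 : DifferentiableAt ℝ ψ x := (hψ.differentiable (by simp)) x
  simp only [act, Pi.smul_apply, fderiv_const_smul h1, _root_.smul_apply, map_smul,
    Finset.smul_sum, smul_add]

/-- The graph of the operator on smooth compactly supported functions. -/
noncomputable def coreGraph (a : FirstOrder k) : Submodule ℂ (L2 k × L2 k) where
  carrier := {p | ∃ ψ : R3 → Cn k, ContDiff ℝ ∞ ψ ∧ HasCompactSupport ψ ∧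
    p.1 =ᵐ[volume] ψ ∧ p.2 =ᵐ[volume] a.act ψ}
  zero_mem' := by
    refine ⟨0, contDiff_const, HasCompactSupport.zero, Lp.coeFn_zero _ _ _, ?_⟩
    have h : a.act (0 : R3 → Cn k) = 0 := by
      funext x
      simp [act]
    rw [h]
    exact Lp.coeFn_zero _ _ _
  add_mem' := by
    rintro p q ⟨ψ, hψ, cψ, h1, h2⟩ ⟨η, hη, cη, h3, h4⟩
    refine ⟨ψ + η, hψ.add hη, cψ.add cη, (Lp.coeFn_add _ _).trans (h1.add h3), ?_⟩
    rw [act_add a hψ hη]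
    exact (Lp.coeFn_add _ _).trans (h2.add h4)
  smul_mem' := by
    rintro z p ⟨ψ, hψ, cψ, h1, h2⟩
    refine ⟨z • ψ, contDiff_const.smul hψ, cψ.smul_left (f := fun _ => z),
      (Lp.coeFn_smul _ _).trans (h1.const_smul z), ?_⟩
    rw [act_smul a z hψ]
    exact (Lp.coeFn_smul _ _).trans (h2.const_smul z)

/-- The functional `u ↦ ∫ s u_b` on `L²`. -/
theorem exists_functional (s : R3 → ℂ) (hs : Continuous s) (cs : HasCompactSupport s)
    (b : Fin k) : ∃ Λ : L2 k →L[ℂ] ℂ, ∀ u : L2 k, Λ u = ∫ x, s x * u x b := by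
  have hc : Continuous fun x => (EuclideanSpace.single b (star (s x)) : Cn k) := by
    have : (fun x => (EuclideanSpace.single b (star (s x)) : Cn k)) =
        fun x => star (s x) • (EuclideanSpace.single b (1 : ℂ) : Cn k) := by
      funext x
      ext i
      simp
    rw [this]
    exact (continuous_star.comp hs).smul continuous_const
  have hcs : HasCompactSupport fun x => (EuclideanSpace.single b (star (s x)) : Cn k) :=
    cs.comp_left (g := fun z : ℂ => (EuclideanSpace.single b (star z) : Cn k)) (by simp)
  have hm : MemLp (fun x => (EuclideanSpace.single b (star (s x)) : Cn k)) 2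
      (volume : Measure R3) := hc.memLp_of_hasCompactSupport hcs
  refine ⟨innerSL ℂ (hm.toLp _), fun u => ?_⟩
  rw [innerSL_apply_apply, L2.inner_def]
  refine integral_congr_ae ?_
  filter_upwards [hm.coeFn_toLp] with x hx
  rw [hx, EuclideanSpace.inner_single_left]
  simp

theorem ibp (s f : R3 → ℂ) (hs : ContDiff ℝ ∞ s) (cs : HasCompactSupport s)
    (hf : ContDiff ℝ ∞ f) (v : R3) :
    ∫ x, s x * fderiv ℝ f x v = - ∫ x, fderiv ℝ s x v * f x := by
  have h1 : Continuous fun x => fderiv ℝ s x v :=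
    (hs.continuous_fderiv (by simp)).clm_apply continuous_const
  have h2 : Continuous fun x => fderiv ℝ f x v :=
    (hf.continuous_fderiv (by simp)).clm_apply continuous_const
  have h3 : HasCompactSupport fun x => fderiv ℝ s x v := cs.fderiv_apply (𝕜 := ℝ) v
  refine integral_mul_fderiv_eq_neg_fderiv_mul_of_integrable
    ((h1.mul hf.continuous).integrable_of_hasCompactSupport h3.mul_right)
    ((hs.continuous.mul h2).integrable_of_hasCompactSupport cs.mul_right)
    ((hs.continuous.mul hf.continuous).integrable_of_hasCompactSupport cs.mul_right)
    (fun x _ => (hs.differentiable (by simp)) x) (fun x _ => (hf.differentiable (by simp)) x)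

theorem coord_apply (L : Cn k →L[ℂ] Cn k) (z : Cn k) (a : Fin k) :
    L z a = ∑ b, L (EuclideanSpace.single b 1) a * z b := by
  have hz : z = ∑ b, z b • (EuclideanSpace.single b (1 : ℂ) : Cn k) := by
    ext i
    simp [Pi.single_apply]
  conv_lhs => rw [hz]
  simp [map_sum, mul_comm]

theorem smooth_coord {L : R3 → (Cn k →L[ℂ] Cn k)} (hL : ContDiff ℝ ∞ L) (a b : Fin k) :
    ContDiff ℝ ∞ fun x => L x (EuclideanSpace.single b 1) a := by
  have h : ContDiff ℝ ∞ fun x => L x (EuclideanSpace.single b 1) :=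
    ((ContinuousLinearMap.apply ℂ (Cn k) (EuclideanSpace.single b (1 : ℂ) : Cn k)).restrictScalars
      ℝ).contDiff.comp hL
  exact ((EuclideanSpace.proj a : Cn k →L[ℂ] ℂ).restrictScalars ℝ).contDiff.comp h

/-- The operator on smooth compactly supported functions is closable: the closure of its graph is
a graph. -/
theorem closable (a : FirstOrder k) :
    ∀ p ∈ a.coreGraph.topologicalClosure, p.1 = 0 → p.2 = 0 := by
  intro p hp hp1
  -- `p.2` is orthogonal to all test functions
  have key : ∀ (g : R3 → ℂ), ContDiff ℝ ∞ g → HasCompactSupport g → ∀ α : Fin k,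
      ∫ x, g x * p.2 x α = 0 := by
    intro g hg cg α
    have hm : ∀ j b, ContDiff ℝ ∞ fun x =>
        g x * a.princ x j (EuclideanSpace.single b 1) α := fun j b =>
      hg.mul (smooth_coord (contDiff_pi.1 a.smooth_princ j) α b)
    have hn : ∀ b, ContDiff ℝ ∞ fun x => g x * a.pot x (EuclideanSpace.single b 1) α := fun b =>
      hg.mul (smooth_coord a.smooth_pot α b)
    have cm : ∀ j b, HasCompactSupport fun x =>
        g x * a.princ x j (EuclideanSpace.single b 1) α := fun j b => cg.mul_right
    have cn : ∀ b, HasCompactSupport fun x =>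
        g x * a.pot x (EuclideanSpace.single b 1) α := fun b => cg.mul_right
    obtain ⟨Λ, hΛ⟩ := exists_functional (k := k) g hg.continuous cg α
    have e1 : ∀ (j : Fin 3) (b : Fin k), ∃ Λ' : L2 k →L[ℂ] ℂ, ∀ u : L2 k, Λ' u = ∫ x,
        fderiv ℝ (fun x => g x * a.princ x j (EuclideanSpace.single b 1) α) x
          (EuclideanSpace.single j 1) * u x b := fun j b =>
      exists_functional _ (((hm j b).continuous_fderiv (by simp)).clm_apply continuous_const)
        ((cm j b).fderiv_apply (𝕜 := ℝ) _) b
    have e2 : ∀ b : Fin k, ∃ Λ' : L2 k →L[ℂ] ℂ, ∀ u : L2 k, Λ' u = ∫ x,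
        (g x * a.pot x (EuclideanSpace.single b 1) α) * u x b := fun b =>
      exists_functional _ (hn b).continuous (cn b) b
    choose Λ₁ hΛ₁ using e1
    choose Λ₂ hΛ₂ using e2
    have main : ∀ q ∈ a.coreGraph, Λ q.2 = -∑ j, ∑ b, Λ₁ j b q.1 + ∑ b, Λ₂ b q.1 := by
      rintro q ⟨ψ, hψ, cψ, h1, h2⟩
      have hψb : ∀ b, ContDiff ℝ ∞ fun x => ψ x b := fun b =>
        ((EuclideanSpace.proj b : Cn k →L[ℂ] ℂ).restrictScalars ℝ).contDiff.comp hψ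
      have hd : ∀ b x v, fderiv ℝ ψ x v b = fderiv ℝ (fun x => ψ x b) x v := by
        intro b x v
        have := (((EuclideanSpace.proj b : Cn k →L[ℂ] ℂ).restrictScalars ℝ).hasFDerivAt.comp x
          ((hψ.differentiable (by simp)) x).hasFDerivAt).fderiv
        have h' := DFunLike.congr_fun this v
        exact h'.symm
      have c1 : ∀ j b, Λ₁ j b q.1 = -∫ x, (g x * a.princ x j (EuclideanSpace.single b 1) α) *
          fderiv ℝ (fun x => ψ x b) x (EuclideanSpace.single j 1) := by
        intro j b
        rw [ibp _ _ (hm j b) (cm j b) (hψb b), neg_neg, hΛ₁]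
        refine integral_congr_ae ?_
        filter_upwards [h1] with x hx
        rw [hx]
      have c2 : ∀ b, Λ₂ b q.1 = ∫ x, (g x * a.pot x (EuclideanSpace.single b 1) α) * ψ x b := by
        intro b
        rw [hΛ₂]
        refine integral_congr_ae ?_
        filter_upwards [h1] with x hx
        rw [hx]
      have i1 : ∀ j b, Integrable (fun x => (g x * a.princ x j (EuclideanSpace.single b 1) α) *
          fderiv ℝ (fun x => ψ x b) x (EuclideanSpace.single j 1)) (volume : Measure R3) :=
        fun j b => ((hm j b).continuous.mul (((hψb b).continuous_fderiv (by simp)).clm_apply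
          continuous_const)).integrable_of_hasCompactSupport (cm j b).mul_right
      have i2 : ∀ b, Integrable (fun x => (g x * a.pot x (EuclideanSpace.single b 1) α) * ψ x b)
          (volume : Measure R3) := fun b => ((hn b).continuous.mul
          (hψb b).continuous).integrable_of_hasCompactSupport (cn b).mul_right
      have c3 : Λ q.2 = ∫ x, (∑ j, ∑ b, (g x * a.princ x j (EuclideanSpace.single b 1) α) *
          fderiv ℝ (fun x => ψ x b) x (EuclideanSpace.single j 1) +
          ∑ b, (g x * a.pot x (EuclideanSpace.single b 1) α) * ψ x b) := by
        rw [hΛ]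
        refine integral_congr_ae ?_
        filter_upwards [h2] with x hx
        rw [hx, act, PiLp.add_apply, coord_apply (a.pot x)]
        rw [show ((∑ j, a.princ x j (fderiv ℝ ψ x (EuclideanSpace.single j 1)) : Cn k)) α =
          ∑ j, (a.princ x j (fderiv ℝ ψ x (EuclideanSpace.single j 1))) α by simp]
        simp only [coord_apply (a.princ x _) (fderiv ℝ ψ x _), hd, mul_add, Finset.mul_sum, mul_assoc]
      rw [c3, integral_add (integrable_finsetSum _ fun j _ => integrable_finsetSum _ fun b _ =>
        i1 j b) (integrable_finsetSum _ fun b _ => i2 b), integral_finsetSum _ (fun j _ =>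
        integrable_finsetSum _ fun b _ => i1 j b), integral_finsetSum _ (fun b _ => i2 b)]
      have s1 : -∑ j, ∑ b, Λ₁ j b q.1 = ∑ j, ∑ b, ∫ x,
          (g x * a.princ x j (EuclideanSpace.single b 1) α) *
          fderiv ℝ (fun x => ψ x b) x (EuclideanSpace.single j 1) := by
        rw [← Finset.sum_neg_distrib]
        refine Finset.sum_congr rfl fun j _ => ?_
        rw [← Finset.sum_neg_distrib]
        exact Finset.sum_congr rfl fun b _ => by rw [c1, neg_neg]
      rw [s1, Finset.sum_congr rfl fun b _ => c2 b]
      congr 1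
      exact Finset.sum_congr rfl fun j _ => integral_finsetSum _ (fun b _ => i1 j b)
    have hcl : IsClosed {q : L2 k × L2 k | Λ q.2 = -∑ j, ∑ b, Λ₁ j b q.1 + ∑ b, Λ₂ b q.1} :=
      isClosed_eq (by fun_prop) (by fun_prop)
    have hpp : p ∈ {q : L2 k × L2 k | Λ q.2 = -∑ j, ∑ b, Λ₁ j b q.1 + ∑ b, Λ₂ b q.1} :=
      closure_minimal main hcl hp
    have hz : Λ p.2 = 0 := by
      have h : Λ p.2 = -∑ j, ∑ b, Λ₁ j b p.1 + ∑ b, Λ₂ b p.1 := hpp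
      rw [h, hp1]
      simp only [map_zero, Finset.sum_const_zero, neg_zero, add_zero]
    rw [← hΛ, hz]
  have hloc : ∀ α, LocallyIntegrable (fun x => p.2 x α) (volume : Measure R3) := by
    intro α
    have h1 : MemLp (fun x => p.2 x α) 2 (volume : Measure R3) :=
      (EuclideanSpace.proj α : Cn k →L[ℂ] ℂ).comp_memLp' (Lp.memLp p.2)
    exact h1.locallyIntegrable (by norm_num)
  have hz : ∀ α, ∀ᵐ x ∂(volume : Measure R3), p.2 x α = 0 := by
    intro α
    refine ae_eq_zero_of_integral_contDiff_smul_eq_zero (hloc α) fun g hg cg => ?_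
    have := key (fun x => (g x : ℂ)) (Complex.ofRealCLM.contDiff.comp hg)
      (cg.comp_left (g := fun t : ℝ => (t : ℂ)) (by simp)) α
    simpa using this
  refine (Lp.eq_zero_iff_ae_eq_zero).2 ?_
  filter_upwards [ae_all_iff.2 hz] with x hx
  ext α
  simpa using hx α

/-- The closed operator on `L²(ℝ³; ℂ^k)` given by `𝒜 · ∇ + ℬ`: the closure of its restriction to
smooth compactly supported functions (which is closable). -/
noncomputable def op (a : FirstOrder k) : L2 k →ₗ.[ℂ] L2 k :=
  a.coreGraph.topologicalClosure.toLinearPMap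

end FirstOrder

/-! ### Multiplication operators and form sums -/

variable {k : ℕ}

/-- The graph of the multiplication operator by a real function `g`. -/
noncomputable def mulGraph (k : ℕ) (g : R3 → ℝ) : Submodule ℂ (L2 k × L2 k) where
  carrier := {p | p.2 =ᵐ[volume] fun x => g x • p.1 x}
  zero_mem' := by
    filter_upwards [Lp.coeFn_zero (Cn k) 2 (volume : Measure R3)] with x hx
    simp only [Prod.fst_zero, Prod.snd_zero, hx, Pi.zero_apply, smul_zero]
  add_mem' := by
    intro p q hp hq
    filter_upwards [hp, hq, Lp.coeFn_add p.1 q.1, Lp.coeFn_add p.2 q.2] with x h1 h2 h3 h4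
    rw [Prod.snd_add, Prod.fst_add, h4, h3, Pi.add_apply, Pi.add_apply, h1, h2, smul_add]
  smul_mem' := by
    intro z p hp
    filter_upwards [hp, Lp.coeFn_smul z p.1, Lp.coeFn_smul z p.2] with x h1 h2 h3
    rw [Prod.smul_snd, Prod.smul_fst, h3, h2, Pi.smul_apply, Pi.smul_apply, h1, smul_comm]

/-- The graph of the multiplication operator is single-valued. -/
theorem mulGraph_isGraph (g : R3 → ℝ) : ∀ p ∈ mulGraph k g, p.1 = 0 → p.2 = 0 := by
  intro p hp h0
  refine (Lp.eq_zero_iff_ae_eq_zero).2 ?_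
  have h1 : p.1 =ᵐ[volume] 0 := (Lp.eq_zero_iff_ae_eq_zero).1 h0
  filter_upwards [hp, h1] with x h2 h3
  rw [h2, h3, Pi.zero_apply, smul_zero]

/-- Multiplication by a real function `g`, on its maximal domain `{u ∈ L² : g u ∈ L²}`. -/
noncomputable def mul (k : ℕ) (g : R3 → ℝ) : L2 k →ₗ.[ℂ] L2 k :=
  (mulGraph k g).toLinearPMap

/-- The graph of the operator `A*A + M*M`, the sum being taken in the sense of quadratic forms, i.e.
of the operator of the form `‖A u‖² + ‖M u‖²` on `D(A) ∩ D(M)`: the vector `u` is in its domain and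
is mapped to `f` iff `u ∈ D(A) ∩ D(M)` and `⟪A v, A u⟫ + ⟪M v, M u⟫ = ⟪v, f⟫` for all
`v ∈ D(A) ∩ D(M)`. -/
noncomputable def formSumGraph (A M : L2 k →ₗ.[ℂ] L2 k) : Submodule ℂ (L2 k × L2 k) where
  carrier := {p | ∃ (hA : p.1 ∈ A.domain) (hM : p.1 ∈ M.domain),
    ∀ (v : L2 k) (hvA : v ∈ A.domain) (hvM : v ∈ M.domain),
      ⟪A ⟨v, hvA⟩, A ⟨p.1, hA⟩⟫_ℂ + ⟪M ⟨v, hvM⟩, M ⟨p.1, hM⟩⟫_ℂ = ⟪v, p.2⟫_ℂ}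
  zero_mem' := by
    refine ⟨A.domain.zero_mem, M.domain.zero_mem, fun v hvA hvM => ?_⟩
    have h1 : A ⟨0, A.domain.zero_mem⟩ = 0 := A.map_zero
    have h2 : M ⟨0, M.domain.zero_mem⟩ = 0 := M.map_zero
    simp [h1, h2]
  add_mem' := by
    rintro p q ⟨hA, hM, h⟩ ⟨hA', hM', h'⟩
    refine ⟨A.domain.add_mem hA hA', M.domain.add_mem hM hM', fun v hvA hvM => ?_⟩
    have h1 : A ⟨(p + q).1, A.domain.add_mem hA hA'⟩ = A ⟨p.1, hA⟩ + A ⟨q.1, hA'⟩ :=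
      A.map_add ⟨p.1, hA⟩ ⟨q.1, hA'⟩
    have h2 : M ⟨(p + q).1, M.domain.add_mem hM hM'⟩ = M ⟨p.1, hM⟩ + M ⟨q.1, hM'⟩ :=
      M.map_add ⟨p.1, hM⟩ ⟨q.1, hM'⟩
    rw [h1, h2, Prod.snd_add, inner_add_right, inner_add_right, inner_add_right,
      ← h v hvA hvM, ← h' v hvA hvM]
    ring
  smul_mem' := by
    rintro z p ⟨hA, hM, h⟩
    refine ⟨A.domain.smul_mem z hA, M.domain.smul_mem z hM, fun v hvA hvM => ?_⟩
    have h1 : A ⟨(z • p).1, A.domain.smul_mem z hA⟩ = z • A ⟨p.1, hA⟩ := A.map_smul z ⟨p.1, hA⟩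
    have h2 : M ⟨(z • p).1, M.domain.smul_mem z hM⟩ = z • M ⟨p.1, hM⟩ := M.map_smul z ⟨p.1, hM⟩
    rw [h1, h2, Prod.smul_snd, inner_smul_right, inner_smul_right, inner_smul_right,
      ← h v hvA hvM]
    ring

/-- The operator `A*A + M*M` (form sum). -/
noncomputable def formSum (A M : L2 k →ₗ.[ℂ] L2 k) : L2 k →ₗ.[ℂ] L2 k :=
  (formSumGraph A M).toLinearPMap

/-- For a first order operator `A`, `T = A*A` and a real function `W ≥ 0`: the operator `T + W`
(form sum of `T` and the multiplication operator by `W`, which is `(√W)*(√W)`). For a bounded `W`,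
in particular for a constant, this is the usual operator sum, with domain `D(T)`. -/
noncomputable def opPlus (a : FirstOrder k) (W : R3 → ℝ) : L2 k →ₗ.[ℂ] L2 k :=
  formSum a.op (mul k fun x => √(W x))

/-- The domain of `T + W` is contained in the domain of `A`. -/
theorem opPlus_domain_le (a : FirstOrder k) (W : R3 → ℝ) :
    (opPlus a W).domain ≤ a.op.domain := by
  rintro u ⟨p, ⟨hA, -⟩, rfl⟩
  exact hA

/-- The value of a partially defined operator, extended by `0` outside of the domain. -/
noncomputable def val (S : L2 k →ₗ.[ℂ] L2 k) (u : L2 k) : L2 k := by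
  classical exact if h : u ∈ S.domain then S ⟨u, h⟩ else 0

/-- `∫ |w u|²`, an extended nonnegative number. -/
noncomputable def weightedNormSq (w : R3 → ℝ) (u : L2 k) : ℝ≥0∞ :=
  ∫⁻ x, (‖w x‖ₑ * ‖u x‖ₑ) ^ 2

/-! ### Tempered length scales, coverings and cutoff functions -/

/-- `ε`-tempered positive functions. -/
def IsTempered (ε : ℝ) (ℓ : R3 → ℝ) : Prop :=
  (∀ x, 0 < ℓ x) ∧ ∀ x y, ‖x - y‖ ≤ ε⁻¹ * ℓ x → 1 / 2 ≤ ℓ y / ℓ x ∧ ℓ y / ℓ x ≤ 2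

/-- The points `x i` form an `ℓ`-uniform set with intersection constant `N`. -/
def IsUniform {ι : Type} (N : ℕ) (ℓ : R3 → ℝ) (x : ι → R3) : Prop :=
  (⋃ i, closedBall (x i) (ℓ (x i) / 10)) = univ ∧
  ∀ j, {i | i ≠ j ∧ (closedBall (x i) (10 * ℓ (x i)) ∩
    closedBall (x j) (10 * ℓ (x j))).Nonempty}.encard ≤ N

/-- The cutoff functions `θ i`, `χ i`, `φ i` attached to the points `x i`; `C` is the constant in
the gradient bound for `θ i`. -/
structure IsCutoff {ι : Type} (C : ℝ) (ℓ : R3 → ℝ) (x : ι → R3) (θ χ φ : ι → R3 → ℝ) :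
    Prop where
  smooth_θ : ∀ i, ContDiff ℝ ∞ (θ i)
  range_θ : ∀ i y, θ i y ∈ Icc (0 : ℝ) 1
  sum_θ : ∀ y, HasSum (fun i => θ i y ^ 2) 1
  supp_θ : ∀ i, tsupport (θ i) ⊆ closedBall (x i) (ℓ (x i))
  grad_θ : ∀ i y, ‖fderiv ℝ (θ i) y‖ ≤ C * (ℓ (x i))⁻¹
  smooth_χ : ∀ i, ContDiff ℝ ∞ (χ i)
  range_χ : ∀ i y, χ i y ∈ Icc (0 : ℝ) 1
  eq_one_χ : ∀ i, ∀ y ∈ closedBall (x i) (4 * ℓ (x i)), χ i y = 1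
  supp_χ : ∀ i, tsupport (χ i) ⊆ closedBall (x i) (5 * ℓ (x i))
  grad_χ : ∀ i y, ‖fderiv ℝ (χ i) y‖ ≤ 2 * (ℓ (x i))⁻¹
  smooth_φ : ∀ i, ContDiff ℝ ∞ (φ i)
  eq_one_φ : ∀ i, ∀ y ∈ closedBall (x i) (4 * ℓ (x i)) \ closedBall (x i) (3 * ℓ (x i)), φ i y = 1
  supp_φ : ∀ i,
    tsupport (φ i) ⊆ closedBall (x i) (5 * ℓ (x i)) \ closedBall (x i) (2 * ℓ (x i))
  grad_φ : ∀ i y, ‖fderiv ℝ (φ i) y‖ ≤ 2 * (ℓ (x i))⁻¹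

/-- The energy shift `P(x) = ε⁻⁵ ℓ(x)⁻²`. -/
noncomputable def shift (ε : ℝ) (ℓ : R3 → ℝ) (x : R3) : ℝ := (ε ^ 5)⁻¹ * (ℓ x ^ 2)⁻¹

end PullIn

/-! The proof is a duality argument combined with localization. Put u₀ = (T+P+μ)⁻¹f and, up to
truncations, g = F u₀ and q = F g, so that ‖g‖² = ⟪q, u₀⟫. If z solves (T+P+μ)z = q, symmetry turns
this into ⟪z, f⟫ = ∑ ⟪z, θᵢ²f⟫, and it remains to pair z with the local sources bᵢ = θᵢ²f.

Let uᵢ = (Tᵢ+Pᵢ)⁻¹bᵢ, vᵢ = Aᵢuᵢ, w = Az, W = P+μ, and let hᵢ be a cutoff equal to 1 on supp θᵢ whose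
gradient lives in the shell where φᵢ = 1. Test the local equation with hᵢz and the global one with
hᵢuᵢ. The leading terms cancel, and what is left is ⟪q, hᵢuᵢ⟫, the mismatch (W−Pᵢ)hᵢ between z and
uᵢ, and the commutators ⟪w, [A,hᵢ]uᵢ⟫ and ⟪[A,hᵢ]z, vᵢ⟫. The last one sees vᵢ only in the shell,
which is the origin of the φᵢ term. Since |∇hᵢ|² is of order ℓᵢ⁻², hence of order ε⁵P, everything is
bounded by 10 F(xᵢ) ∫ X Yᵢ over the ball of radius 10ℓᵢ, with X = |g| + (W/F)|z| + (√W/F)|w| and Yᵢ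
= |uᵢ| + Pᵢ^(-1/2)|φᵢvᵢ| (`IsWeakSol.enorm_inner_le_weighted`).

The analytic input is ∫X² ≤ const·‖g‖² (`IsWeakSol.weighted_energy_final`), an energy estimate with
weight √W/F. The weight is only measurable and cannot be commuted with A. It is frozen at xᵢ
instead, the equation is tested with θᵢ²z, and the results are summed using the finite overlap. The
localization error is of order ε⁵W|z|² and is absorbed for small ε.

By Young's inequality, ‖g‖² ≤ ½‖g‖² + const·∑ F(xᵢ)²∫Yᵢ². All constants are uniform in μ, because
adding μ ≥ 0 does not spoil the slow variation of P. So μ may be replaced by μ+δ to make the dual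
equation solvable, after which δ → 0 and the truncations are removed by monotone convergence. -/

namespace PullIn

/-! ### Closed forms and self-adjointness in an abstract Hilbert space -/

section Abstract

variable {H : Type*} [NormedAddCommGroup H] [InnerProductSpace ℂ H] [CompleteSpace H]

/-- The weak equation `(A*A + M*M + δ) u = f` is solvable for closed graphs `G`, `M`. -/
theorem exists_form_solution (G M : Submodule ℂ (H × H)) (hG : IsClosed (G : Set (H × H)))
    (hM : IsClosed (M : Set (H × H))) {δ : ℝ} (hδ : 0 < δ) (f : H) :
    ∃ u w m, (u, w) ∈ G ∧ (u, m) ∈ M ∧ ∀ v w' m', (v, w') ∈ G → (v, m') ∈ M →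
      ⟪w', w⟫_ℂ + ⟪m', m⟫_ℂ + δ * ⟪v, u⟫_ℂ = ⟪v, f⟫_ℂ := by
  set s : ℝ := √δ with hs
  have hs0 : 0 < s := Real.sqrt_pos.2 hδ
  have hss : (s : ℂ) * s = δ := by
    rw [← Complex.ofReal_mul, Real.mul_self_sqrt hδ.le]
  have hsc : (s : ℂ) ≠ 0 := by exact_mod_cast hs0.ne'
  -- `K` is the set of (√δ v, w', m') with (v, w') in `G` and (v, m') in `M`, a copy of the form
  -- domain in which the norm of the ambient space is the form norm. Projecting (f/√δ, 0, 0)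
  -- orthogonally onto it gives (√δ u, w, m), and orthogonality of the residual is the weak
  -- equation. Density of the domains plays no role.
  let E := PiLp 2 (fun _ : Fin 3 => H)
  let pr : Fin 3 → E →L[ℂ] H := fun i => PiLp.proj 2 (fun _ : Fin 3 => H) i
  let L1 : E →L[ℂ] H × H := ((s : ℂ)⁻¹ • pr 0).prod (pr 1)
  let L2' : E →L[ℂ] H × H := ((s : ℂ)⁻¹ • pr 0).prod (pr 2)
  let K : Submodule ℂ E := G.comap L1.toLinearMap ⊓ M.comap L2'.toLinearMap
  have hK : IsClosed (K : Set E) :=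
    (hG.preimage L1.continuous).inter (hM.preimage L2'.continuous)
  let e : E := WithLp.toLp 2 ![(s : ℂ)⁻¹ • f, 0, 0]
  obtain ⟨y, hy, hy'⟩ := Submodule.exists_norm_eq_iInf_of_complete_subspace K hK.isComplete e
  replace hy' := (K.norm_eq_iInf_iff_inner_eq_zero hy).1 hy'
  refine ⟨(s : ℂ)⁻¹ • y 0, y 1, y 2, hy.1, hy.2, fun v w' m' hv1 hv2 => ?_⟩
  have hx : (WithLp.toLp 2 ![(s : ℂ) • v, w', m'] : E) ∈ K := by
    refine ⟨?_, ?_⟩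
    · change ((s : ℂ)⁻¹ • (s : ℂ) • v, w') ∈ G
      rwa [inv_smul_smul₀ hsc]
    · change ((s : ℂ)⁻¹ • (s : ℂ) • v, m') ∈ M
      rwa [inv_smul_smul₀ hsc]
  have h := hy' _ hx
  rw [← inner_conj_symm, map_eq_zero] at h
  rw [PiLp.inner_apply, Fin.sum_univ_three] at h
  have h' : ⟪(s : ℂ) • v, (s : ℂ)⁻¹ • f - y 0⟫_ℂ + ⟪w', 0 - y 1⟫_ℂ + ⟪m', 0 - y 2⟫_ℂ = 0 := h
  rw [inner_smul_left, inner_sub_right, inner_smul_right, zero_sub, zero_sub, inner_neg_right,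
    inner_neg_right, Complex.conj_ofReal] at h'
  rw [inner_smul_right, ← hss]
  have e1 : (s : ℂ) * ((s : ℂ)⁻¹ * ⟪v, f⟫_ℂ) = ⟪v, f⟫_ℂ := by field_simp
  have e2 : (s : ℂ) * s * ((s : ℂ)⁻¹ * ⟪v, y 0⟫_ℂ) = s * ⟪v, y 0⟫_ℂ := by field_simp
  rw [e2]
  linear_combination -h' + e1

/-- A symmetric nonnegative operator `S` such that `S + 1` is surjective is self-adjoint. -/
theorem isSelfAdjoint_of_surjective (S : H →ₗ.[ℂ] H)
    (symm : ∀ u f v g, (u, f) ∈ S.graph → (v, g) ∈ S.graph → ⟪f, v⟫_ℂ = ⟪u, g⟫_ℂ)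
    (nonneg : ∀ u f, (u, f) ∈ S.graph → 0 ≤ (⟪u, f⟫_ℂ).re)
    (surj : ∀ f, ∃ u, (u, f - u) ∈ S.graph) : IsSelfAdjoint S := by
  -- If `w` is orthogonal to the domain and Su + u = w, then ⟪u, Su⟫ = −‖u‖², which forces u = 0 and
  -- hence w = 0.
  have hd : Dense (S.domain : Set H) := by
    rw [Submodule.dense_iff_topologicalClosure_eq_top, Submodule.topologicalClosure_eq_top_iff,
      Submodule.eq_bot_iff]
    intro w hw
    obtain ⟨u, hu⟩ := surj w
    have h1 : ⟪u, w⟫_ℂ = 0 := hw u (LinearPMap.mem_domain_of_mem_graph hu)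
    have h2 := nonneg _ _ hu
    rw [inner_sub_right, h1, zero_sub, Complex.neg_re, inner_self_eq_norm_sq_to_K] at h2
    have h3 : ‖u‖ = 0 := by
      have : 0 ≤ -(‖u‖ ^ 2) := by exact_mod_cast h2
      nlinarith [norm_nonneg u]
    have h4 : u = 0 := norm_eq_zero.1 h3
    subst h4
    simpa using S.graph_fst_eq_zero_snd hu rfl
  rw [LinearPMap.isSelfAdjoint_def]
  have hle : S ≤ S.adjoint := by
    refine LinearPMap.IsFormalAdjoint.le_adjoint hd fun x y => ?_
    exact symm _ _ _ _ (S.mem_graph x) (S.mem_graph y)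
  refine le_antisymm ?_ hle
  refine LinearPMap.le_of_le_graph ?_
  rintro ⟨y, g⟩ hy
  obtain ⟨u, hu⟩ := surj (g + y)
  obtain ⟨y', hy1, hy2⟩ := (LinearPMap.mem_graph_iff _).1 hy
  -- The difference y − u is orthogonal to the range of S + 1, which is everything. The vector `x`
  -- solves (S+1)x = y − u.
  have key : y = u := by
    rw [← sub_eq_zero, ← inner_self_eq_zero (𝕜 := ℂ)]
    obtain ⟨x, hx⟩ := surj (y - u)
    obtain ⟨x', hx1, hx2⟩ := (LinearPMap.mem_graph_iff _).1 hx
    have h1 := LinearPMap.adjoint_isFormalAdjoint hd y' x'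
    have h2 := symm _ _ _ _ hu hx
    simp only at hx1 hx2 hy1 hy2
    rw [hy1, hy2, hx1, hx2] at h1
    simp only [inner_sub_left, inner_sub_right, inner_add_left] at h1 h2 ⊢
    linear_combination -h1 + h2
  subst key
  simpa using hu

end Abstract

/-! ### Weak solutions of (A*A + W)u = f and the operators they define -/

variable {k : ℕ}

/-- Convergence in `L²` gives almost everywhere convergence along a subsequence, where the defining
relation passes to the limit. The second subsequence is extracted from the first so that both
components converge together. -/
theorem isClosed_mulGraph (g : R3 → ℝ) :
    IsClosed (mulGraph k g : Set (L2 k × L2 k)) := by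
  refine IsSeqClosed.isClosed fun s p hs hp => ?_
  have h1 : Filter.Tendsto (fun n => (s n).1) Filter.atTop (nhds p.1) :=
    (continuous_fst.tendsto p).comp hp
  have h2 : Filter.Tendsto (fun n => (s n).2) Filter.atTop (nhds p.2) :=
    (continuous_snd.tendsto p).comp hp
  obtain ⟨φ, hφ, hφ1⟩ := (tendstoInMeasure_of_tendsto_Lp h1).exists_seq_tendsto_ae
  obtain ⟨ψ, hψ, hψ1⟩ := (tendstoInMeasure_of_tendsto_Lp
    (h2.comp hφ.tendsto_atTop)).exists_seq_tendsto_ae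
  have hall : ∀ᵐ x ∂(volume : Measure R3), ∀ n, (s n).2 x = g x • (s n).1 x :=
    ae_all_iff.2 hs
  change p.2 =ᵐ[volume] fun x => g x • p.1 x
  filter_upwards [hφ1, hψ1, hall] with x a1 a2 a3
  have a4 := (a1.comp hψ.tendsto_atTop).const_smul (g x)
  refine tendsto_nhds_unique a2 (a4.congr fun n => ?_)
  exact (a3 _).symm


/-- The graph of the closed operator `a.op`. -/
noncomputable abbrev FirstOrder.closedGraph (a : FirstOrder k) : Submodule ℂ (L2 k × L2 k) :=
  a.coreGraph.topologicalClosure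

theorem FirstOrder.op_graph (a : FirstOrder k) : a.op.graph = a.closedGraph :=
  Submodule.toLinearPMap_graph_eq _ a.closable

theorem mul_graph (g : R3 → ℝ) : (mul k g).graph = mulGraph k g :=
  Submodule.toLinearPMap_graph_eq _ (mulGraph_isGraph g)

theorem mem_mulGraph {g : R3 → ℝ} {u m : L2 k} :
    (u, m) ∈ mulGraph k g ↔ m =ᵐ[volume] fun x => g x • u x := Iff.rfl

/-- Measurable, nonnegative and locally bounded functions. -/
structure IsPotential (W : R3 → ℝ) : Prop where
  measurable : Measurable W
  nonneg : ∀ x, 0 ≤ W x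
  locally_bounded : ∀ K, IsCompact K → ∃ B, ∀ x ∈ K, W x ≤ B

theorem IsPotential.add_const {W : R3 → ℝ} (hW : IsPotential W) {δ : ℝ} (hδ : 0 ≤ δ) :
    IsPotential fun x => W x + δ where
  measurable := hW.measurable.add_const δ
  nonneg x := add_nonneg (hW.nonneg x) hδ
  locally_bounded K hK := by
    obtain ⟨B, hB⟩ := hW.locally_bounded K hK
    exact ⟨B + δ, fun x hx => by linarith [hB x hx]⟩

/-- The vector `u` is a weak solution of `(a* a + W) u = f` with `a u = w`. -/
def IsWeakSol (a : FirstOrder k) (W : R3 → ℝ) (u w f : L2 k) : Prop :=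
  (u, w) ∈ a.closedGraph ∧ ∃ m, (u, m) ∈ mulGraph k (fun x => √(W x)) ∧
    ∀ v w' m', (v, w') ∈ a.closedGraph → (v, m') ∈ mulGraph k (fun x => √(W x)) →
      ⟪w', w⟫_ℂ + ⟪m', m⟫_ℂ = ⟪v, f⟫_ℂ

/-- Passing from partial functions to graphs removes the domain proofs from the weak equation; all
later arguments work with graphs. -/
theorem mem_formSumGraph {A M : L2 k →ₗ.[ℂ] L2 k} {u f : L2 k} :
    (u, f) ∈ formSumGraph A M ↔ ∃ w m, (u, w) ∈ A.graph ∧ (u, m) ∈ M.graph ∧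
      ∀ v w' m', (v, w') ∈ A.graph → (v, m') ∈ M.graph →
        ⟪w', w⟫_ℂ + ⟪m', m⟫_ℂ = ⟪v, f⟫_ℂ := by
  constructor
  · rintro ⟨hA, hM, h⟩
    refine ⟨_, _, A.mem_graph ⟨u, hA⟩, M.mem_graph ⟨u, hM⟩, fun v w' m' h1 h2 => ?_⟩
    obtain ⟨⟨v1, hv1⟩, rfl, rfl⟩ := (LinearPMap.mem_graph_iff _).1 h1
    obtain ⟨⟨v2, hv2⟩, e, rfl⟩ := (LinearPMap.mem_graph_iff _).1 h2
    simp only at e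
    subst e
    exact h v2 hv1 hv2
  · rintro ⟨w, m, h1, h2, h⟩
    obtain ⟨⟨v1, hv1⟩, rfl, rfl⟩ := (LinearPMap.mem_graph_iff _).1 h1
    obtain ⟨⟨v2, hv2⟩, e, rfl⟩ := (LinearPMap.mem_graph_iff _).1 h2
    simp only at e
    subst e
    exact ⟨hv1, hv2, fun v hvA hvM => h v _ _ (A.mem_graph ⟨v, hvA⟩) (M.mem_graph ⟨v, hvM⟩)⟩

theorem mem_formSumGraph_op {a : FirstOrder k} {W : R3 → ℝ} {u f : L2 k} :
    (u, f) ∈ formSumGraph a.op (mul k fun x => √(W x)) ↔ ∃ w, IsWeakSol a W u w f := by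
  rw [mem_formSumGraph, a.op_graph, mul_graph]
  constructor
  · rintro ⟨w, m, h1, h2, h⟩
    exact ⟨w, h1, m, h2, h⟩
  · rintro ⟨w, h1, m, h2, h⟩
    exact ⟨w, m, h1, h2, h⟩

theorem memLp_smul_of_locally_bounded {g : R3 → ℝ} (hg : Measurable g)
    (hb : ∀ K, IsCompact K → ∃ B, ∀ x ∈ K, |g x| ≤ B) {ψ : R3 → Cn k} (hψ : Continuous ψ)
    (cψ : HasCompactSupport ψ) : MemLp (fun x => g x • ψ x) 2 (volume : Measure R3) := by
  obtain ⟨B, hB⟩ := hb _ cψ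
  refine (hψ.memLp_of_hasCompactSupport cψ (p := 2) (μ := volume)).of_le_mul (c := B)
    (hg.aestronglyMeasurable.smul hψ.aestronglyMeasurable) (ae_of_all _ fun x => ?_)
  rw [norm_smul]
  by_cases hx : x ∈ tsupport ψ
  · exact mul_le_mul_of_nonneg_right (hB x hx) (norm_nonneg _)
  · simp [image_eq_zero_of_notMem_tsupport hx]

theorem FirstOrder.continuous_act (a : FirstOrder k) {ψ : R3 → Cn k} (hψ : ContDiff ℝ ∞ ψ) :
    Continuous (a.act ψ) := by
  have h1 : ∀ j, Continuous fun x => a.princ x j := fun j =>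
    (continuous_apply j).comp a.smooth_princ.continuous
  have h2 : ∀ v, Continuous fun x => fderiv ℝ ψ x v := fun v =>
    (hψ.continuous_fderiv (by simp)).clm_apply continuous_const
  exact (continuous_finsetSum _ fun j _ => (h1 j).clm_apply (h2 _)).add
    (a.smooth_pot.continuous.clm_apply hψ.continuous)

theorem FirstOrder.hasCompactSupport_act (a : FirstOrder k) {ψ : R3 → Cn k}
    (cψ : HasCompactSupport ψ) : HasCompactSupport (a.act ψ) := by
  refine HasCompactSupport.intro cψ fun x hx => ?_
  have h1 : ψ x = 0 := image_eq_zero_of_notMem_tsupport hx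
  have h2 : fderiv ℝ ψ x = 0 :=
    image_eq_zero_of_notMem_tsupport fun h => hx (tsupport_fderiv_subset ℝ h)
  simp [FirstOrder.act, h1, h2]

/-- Test functions belong to the form domain. -/
theorem exists_test_mem {a : FirstOrder k} {W : R3 → ℝ} (hW : IsPotential W) {ψ : R3 → Cn k}
    (hψ : ContDiff ℝ ∞ ψ) (cψ : HasCompactSupport ψ) : ∃ v w m : L2 k, v =ᵐ[volume] ψ ∧
      (v, w) ∈ a.closedGraph ∧ (v, m) ∈ mulGraph k (fun x => √(W x)) := by
  have h1 : MemLp ψ 2 (volume : Measure R3) := hψ.continuous.memLp_of_hasCompactSupport cψ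
  have h2 : MemLp (a.act ψ) 2 (volume : Measure R3) :=
    (a.continuous_act hψ).memLp_of_hasCompactSupport (a.hasCompactSupport_act cψ)
  have h3 : MemLp (fun x => √(W x) • ψ x) 2 (volume : Measure R3) := by
    refine memLp_smul_of_locally_bounded hW.measurable.sqrt (fun K hK => ?_) hψ.continuous cψ
    obtain ⟨B, hB⟩ := hW.locally_bounded K hK
    exact ⟨√B, fun x hx => by rw [abs_of_nonneg (Real.sqrt_nonneg _)]
                              exact Real.sqrt_le_sqrt (hB x hx)⟩
  refine ⟨h1.toLp _, h2.toLp _, h3.toLp _, h1.coeFn_toLp, subset_closure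
    ⟨ψ, hψ, cψ, h1.coeFn_toLp, h2.coeFn_toLp⟩, ?_⟩
  rw [mem_mulGraph]
  filter_upwards [h1.coeFn_toLp, h3.coeFn_toLp] with x hx hx'
  rw [hx, hx']

/-- A vector which is orthogonal to all test functions vanishes. -/
theorem eq_zero_of_orthogonal_test (f : L2 k)
    (h : ∀ ψ : R3 → Cn k, ContDiff ℝ ∞ ψ → HasCompactSupport ψ → ∀ v : L2 k, v =ᵐ[volume] ψ →
      ⟪v, f⟫_ℂ = 0) : f = 0 := by
  have hloc : ∀ α, LocallyIntegrable (fun x => f x α) (volume : Measure R3) := by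
    intro α
    have h1 : MemLp (fun x => f x α) 2 (volume : Measure R3) :=
      (EuclideanSpace.proj α : Cn k →L[ℂ] ℂ).comp_memLp' (Lp.memLp f)
    exact h1.locallyIntegrable (by norm_num)
  have hz : ∀ α, ∀ᵐ x ∂(volume : Measure R3), f x α = 0 := by
    intro α
    refine ae_eq_zero_of_integral_contDiff_smul_eq_zero (hloc α) fun g hg cg => ?_
    have hψ : ContDiff ℝ ∞ fun x => g x • (EuclideanSpace.single α (1 : ℂ) : Cn k) :=
      hg.smul contDiff_const
    have cψ : HasCompactSupport fun x => g x • (EuclideanSpace.single α (1 : ℂ) : Cn k) :=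
      cg.smul_right
    have hm : MemLp (fun x => g x • (EuclideanSpace.single α (1 : ℂ) : Cn k)) 2
      (volume : Measure R3) := hψ.continuous.memLp_of_hasCompactSupport cψ
    rw [← h _ hψ cψ (hm.toLp _) hm.coeFn_toLp, L2.inner_def]
    refine integral_congr_ae ?_
    filter_upwards [hm.coeFn_toLp] with x hx
    rw [hx, ← Complex.coe_smul (g x) (EuclideanSpace.single α (1 : ℂ) : Cn k), inner_smul_left,
      EuclideanSpace.inner_single_left]
    simp
  refine (Lp.eq_zero_iff_ae_eq_zero).2 ?_
  filter_upwards [ae_all_iff.2 hz] with x hx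
  ext α
  simpa using hx α

/-- The form domain contains the test functions because `W` is locally bounded, so a right-hand side
belonging to u = 0 is orthogonal to a dense set. Without this, `Submodule.toLinearPMap` need not
have the intended graph. -/
theorem formSumGraph_isGraph (a : FirstOrder k) {W : R3 → ℝ} (hW : IsPotential W) :
    ∀ p ∈ formSumGraph a.op (mul k fun x => √(W x)), p.1 = 0 → p.2 = 0 := by
  rintro ⟨u, f⟩ hp (rfl : u = 0)
  obtain ⟨w, h1, m, h2, h⟩ := mem_formSumGraph_op.1 hp
  have hw : w = 0 := a.closable _ h1 rfl
  have hm : m = 0 := mulGraph_isGraph _ _ h2 rfl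
  subst hw hm
  refine eq_zero_of_orthogonal_test f fun ψ hψ cψ v hv => ?_
  obtain ⟨v', w', m', e1, e2, e3⟩ := exists_test_mem (a := a) hW hψ cψ
  have e : v' = v := Lp.ext (e1.trans hv.symm)
  subst e
  simpa using (h _ _ _ e2 e3).symm

theorem mem_opPlus_graph {a : FirstOrder k} {W : R3 → ℝ} (hW : IsPotential W) {u f : L2 k} :
    (u, f) ∈ (opPlus a W).graph ↔ ∃ w, IsWeakSol a W u w f := by
  rw [opPlus, formSum, Submodule.toLinearPMap_graph_eq _ (formSumGraph_isGraph a hW),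
    mem_formSumGraph_op]

/-- Nonnegative weights may be split additively in the quadratic form. -/
theorem inner_sqrt_add_const {W : R3 → ℝ} (hW : ∀ x, 0 ≤ W x) {δ : ℝ} (hδ : 0 ≤ δ)
    {u v m m' n n' : L2 k} (hu : (u, m) ∈ mulGraph k (fun x => √(W x)))
    (hv : (v, m') ∈ mulGraph k (fun x => √(W x)))
    (hu' : (u, n) ∈ mulGraph k (fun x => √(W x + δ)))
    (hv' : (v, n') ∈ mulGraph k (fun x => √(W x + δ))) :
    ⟪n', n⟫_ℂ = ⟪m', m⟫_ℂ + δ * ⟪v, u⟫_ℂ := by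
  rw [mem_mulGraph] at *
  rw [L2.inner_def, L2.inner_def, L2.inner_def, ← integral_const_mul,
    ← integral_add (L2.integrable_inner _ _) ((L2.integrable_inner _ _).const_mul _)]
  refine integral_congr_ae ?_
  filter_upwards [hu, hv, hu', hv'] with x h1 h2 h3 h4
  rw [h1, h2, h3, h4]
  simp only [← Complex.coe_smul, inner_smul_left, inner_smul_right, Complex.conj_ofReal,
    ← mul_assoc, ← Complex.ofReal_mul]
  rw [Real.mul_self_sqrt (hW x), Real.mul_self_sqrt (add_nonneg (hW x) hδ)]
  push_cast
  ring

theorem exists_mulGraph_sqrt_add_const {W : R3 → ℝ} (mW : Measurable W) (hW : ∀ x, 0 ≤ W x)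
    {δ : ℝ} (hδ : 0 ≤ δ) (u : L2 k) :
    (∃ m, (u, m) ∈ mulGraph k (fun x => √(W x))) ↔
      ∃ m, (u, m) ∈ mulGraph k (fun x => √(W x + δ)) := by
  simp only [mem_mulGraph]
  constructor
  · rintro ⟨m, hm⟩
    have h : MemLp (fun x => √(W x + δ) • u x) 2 (volume : Measure R3) := by
      refine MemLp.of_le ((Lp.memLp m).norm.add ((Lp.memLp u).norm.const_mul √δ))
        ((mW.add_const δ).sqrt.aestronglyMeasurable.smul (Lp.aestronglyMeasurable u)) ?_
      filter_upwards [hm] with x hx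
      simp only [Pi.add_apply]
      rw [hx, norm_smul, norm_smul, Real.norm_of_nonneg (Real.sqrt_nonneg _),
        Real.norm_of_nonneg (Real.sqrt_nonneg _), ← add_mul, Real.norm_of_nonneg (by positivity)]
      exact mul_le_mul_of_nonneg_right (Real.sqrt_le_iff.2 ⟨by positivity, by
        nlinarith [Real.sq_sqrt (hW x), Real.sq_sqrt hδ, Real.sqrt_nonneg (W x), Real.sqrt_nonneg δ,
          mul_nonneg (Real.sqrt_nonneg (W x)) (Real.sqrt_nonneg δ)]⟩) (norm_nonneg _)
    exact ⟨h.toLp _, h.coeFn_toLp⟩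
  · rintro ⟨m, hm⟩
    have h : MemLp (fun x => √(W x) • u x) 2 (volume : Measure R3) := by
      refine MemLp.of_le (Lp.memLp m)
        (mW.sqrt.aestronglyMeasurable.smul (Lp.aestronglyMeasurable u)) ?_
      filter_upwards [hm] with x hx
      rw [hx, norm_smul, norm_smul, Real.norm_of_nonneg (Real.sqrt_nonneg _),
        Real.norm_of_nonneg (Real.sqrt_nonneg _)]
      gcongr
      linarith
    exact ⟨h.toLp _, h.coeFn_toLp⟩

/-- A constant can be moved between the potential and the right-hand side, since √W and √(W+δ) have
the same maximal domain. This serves both for self-adjointness and for the δ-regularization of the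
dual equation. -/
theorem isWeakSol_add_const {a : FirstOrder k} {W : R3 → ℝ} (mW : Measurable W)
    (hW : ∀ x, 0 ≤ W x) {δ : ℝ} (hδ : 0 ≤ δ) {u w f : L2 k} :
    IsWeakSol a (fun x => W x + δ) u w f ↔ IsWeakSol a W u w (f - (δ : ℂ) • u) := by
  constructor
  · rintro ⟨h1, n, hn, h⟩
    obtain ⟨m, hm⟩ := (exists_mulGraph_sqrt_add_const mW hW hδ u).2 ⟨n, hn⟩
    refine ⟨h1, m, hm, fun v w' m' e1 e2 => ?_⟩
    obtain ⟨n', hn'⟩ := (exists_mulGraph_sqrt_add_const mW hW hδ v).1 ⟨m', e2⟩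
    have := h v w' n' e1 hn'
    rw [inner_sqrt_add_const hW hδ hm e2 hn hn'] at this
    rw [inner_sub_right, inner_smul_right, ← this]
    ring
  · rintro ⟨h1, m, hm, h⟩
    obtain ⟨n, hn⟩ := (exists_mulGraph_sqrt_add_const mW hW hδ u).1 ⟨m, hm⟩
    refine ⟨h1, n, hn, fun v w' n' e1 e2 => ?_⟩
    obtain ⟨m', hm'⟩ := (exists_mulGraph_sqrt_add_const mW hW hδ v).2 ⟨n', e2⟩
    have := h v w' m' e1 hm'
    rw [inner_sub_right, inner_smul_right] at this
    rw [inner_sqrt_add_const hW hδ hm hm' hn e2]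
    linear_combination this

theorem exists_isWeakSol_add_const (a : FirstOrder k) {W : R3 → ℝ} (mW : Measurable W)
    (hW : ∀ x, 0 ≤ W x) {δ : ℝ} (hδ : 0 < δ) (f : L2 k) :
    ∃ u w, IsWeakSol a (fun x => W x + δ) u w f := by
  obtain ⟨u, w, m, h1, h2, h⟩ := exists_form_solution a.closedGraph
    (mulGraph k fun x => √(W x)) (Submodule.isClosed_topologicalClosure _)
    (isClosed_mulGraph _) hδ f
  refine ⟨u, w, (isWeakSol_add_const mW hW hδ.le).2 ⟨h1, m, h2, fun v w' m' e1 e2 => ?_⟩⟩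
  rw [inner_sub_right, inner_smul_right, ← h v w' m' e1 e2]
  ring

theorem isSelfAdjoint_opPlus (a : FirstOrder k) {W : R3 → ℝ} (hW : IsPotential W) :
    IsSelfAdjoint (opPlus a W) := by
  refine isSelfAdjoint_of_surjective _ ?_ ?_ ?_
  · intro u f v g hu hv
    obtain ⟨w, h1, m, h2, h⟩ := (mem_opPlus_graph hW).1 hu
    obtain ⟨w', h1', m', h2', h'⟩ := (mem_opPlus_graph hW).1 hv
    rw [← h' _ _ _ h1 h2, ← inner_conj_symm, ← h _ _ _ h1' h2', map_add, inner_conj_symm,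
      inner_conj_symm]
  · intro u f hu
    obtain ⟨w, h1, m, h2, h⟩ := (mem_opPlus_graph hW).1 hu
    rw [← h _ _ _ h1 h2, Complex.add_re]
    exact add_nonneg (inner_self_nonneg (𝕜 := ℂ)) (inner_self_nonneg (𝕜 := ℂ))
  · intro f
    obtain ⟨u, w, h⟩ := exists_isWeakSol_add_const a hW.measurable hW.nonneg one_pos f
    refine ⟨u, (mem_opPlus_graph hW).2 ⟨w, ?_⟩⟩
    simpa using (isWeakSol_add_const hW.measurable hW.nonneg zero_le_one).1 h

/-- The form of a kernel vector vanishes, so √W u = 0. Pointwise positivity of `W` suffices; no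
positive lower bound is needed. -/
theorem ker_opPlus (a : FirstOrder k) {W : R3 → ℝ} (hW : IsPotential W) (pos : ∀ x, 0 < W x) :
    (opPlus a W).toFun.ker = ⊥ := by
  rw [LinearMap.ker_eq_bot']
  rintro u hu
  have hg := (opPlus a W).mem_graph u
  have hu' : (opPlus a W) u = 0 := hu
  rw [hu'] at hg
  obtain ⟨w, h1, m, h2, h⟩ := (mem_opPlus_graph hW).1 hg
  have h3 := h _ _ _ h1 h2
  rw [inner_zero_right] at h3
  have h4 := congrArg Complex.re h3
  rw [Complex.add_re, Complex.zero_re] at h4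
  have h5 : (⟪m, m⟫_ℂ).re = 0 := by
    have e1 : 0 ≤ (⟪m, m⟫_ℂ).re := inner_self_nonneg (𝕜 := ℂ)
    have e2 : 0 ≤ (⟪w, w⟫_ℂ).re := inner_self_nonneg (𝕜 := ℂ)
    linarith
  have h6 : m = 0 := by
    rw [inner_self_eq_norm_sq_to_K] at h5
    have : ‖m‖ ^ 2 = 0 := by exact_mod_cast h5
    simpa using this
  subst h6
  have h7 : (u : L2 k) = 0 := by
    refine (Lp.eq_zero_iff_ae_eq_zero).2 ?_
    filter_upwards [mem_mulGraph.1 h2, Lp.coeFn_zero (Cn k) 2 (volume : Measure R3)] with x e1 e2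
    rw [e2] at e1
    exact (smul_eq_zero.1 e1.symm).resolve_left (Real.sqrt_pos.2 (pos x)).ne'
  exact Subtype.ext h7

theorem mem_opPlus_inverse_graph {a : FirstOrder k} {W : R3 → ℝ} (hW : IsPotential W)
    (pos : ∀ x, 0 < W x) {u f : L2 k} :
    (f, u) ∈ (opPlus a W).inverse.graph ↔ ∃ w, IsWeakSol a W u w f := by
  rw [LinearPMap.inverse_graph (ker_opPlus a hW pos), ← mem_opPlus_graph hW, Submodule.mem_map]
  constructor
  · rintro ⟨⟨x, y⟩, h, e⟩
    obtain ⟨rfl, rfl⟩ := Prod.mk.inj e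
    exact h
  · exact fun h => ⟨_, h, rfl⟩

/-- Apply the solvability result to the nonnegative potential W − δ, with the constant δ added back.
-/
theorem opPlus_inverse_domain (a : FirstOrder k) {W : R3 → ℝ} (hW : IsPotential W) {δ : ℝ}
    (hδ : 0 < δ) (hWδ : ∀ x, δ ≤ W x) : (opPlus a W).inverse.domain = ⊤ := by
  refine Submodule.eq_top_iff'.2 fun f => ?_
  obtain ⟨u, w, h⟩ := exists_isWeakSol_add_const a (hW.measurable.sub_const δ)
    (fun x => sub_nonneg.2 (hWδ x)) hδ f
  simp only [sub_add_cancel] at h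
  exact LinearPMap.mem_domain_of_mem_graph
    ((mem_opPlus_inverse_graph hW fun x => hδ.trans_le (hWδ x)).2 ⟨w, h⟩)

theorem val_eq_of_mem_graph {S : L2 k →ₗ.[ℂ] L2 k} {u f : L2 k} (h : (u, f) ∈ S.graph) :
    val S u = f := by
  obtain ⟨⟨v, hv⟩, rfl, rfl⟩ := (LinearPMap.mem_graph_iff _).1 h
  simp [val, hv]


/-! ### Multiplication operators, commutators and cutoff functions -/

/-- Multiplication by a continuous compactly supported matrix function is bounded on `L²`. -/
theorem exists_mulOp (m : R3 → (Cn k →L[ℂ] Cn k)) (hm : Continuous m) (cm : HasCompactSupport m) :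
    ∃ Λ : L2 k →L[ℂ] L2 k, ∀ u : L2 k, Λ u =ᵐ[volume] fun x => m x (u x) := by
  obtain ⟨B, hB⟩ := cm.exists_bound_of_continuous hm
  have hmem : ∀ u : L2 k, MemLp (fun x => m x (u x)) 2 (volume : Measure R3) := fun u =>
    (Lp.memLp u).of_le_mul (c := B)
      (Continuous.comp_aestronglyMeasurable₂ (g := fun (L : Cn k →L[ℂ] Cn k) v => L v)
        (by fun_prop) hm.aestronglyMeasurable (Lp.aestronglyMeasurable u))
      (ae_of_all _ fun x => (m x).le_of_opNorm_le (hB x) _)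
  let Λ₀ : L2 k →ₗ[ℂ] L2 k :=
    { toFun := fun u => (hmem u).toLp _
      map_add' := fun u v => by
        refine Lp.ext ?_
        filter_upwards [(hmem (u + v)).coeFn_toLp, (hmem u).coeFn_toLp, (hmem v).coeFn_toLp,
          Lp.coeFn_add u v, Lp.coeFn_add ((hmem u).toLp _) ((hmem v).toLp _)] with x h1 h2 h3 h4 h5
        rw [h1, h5, Pi.add_apply, h2, h3, h4, Pi.add_apply, map_add]
      map_smul' := fun z u => by
        refine Lp.ext ?_
        filter_upwards [(hmem (z • u)).coeFn_toLp, (hmem u).coeFn_toLp, Lp.coeFn_smul z u,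
          Lp.coeFn_smul z ((hmem u).toLp _)] with x h1 h2 h3 h4
        rw [RingHom.id_apply, h1, h4, Pi.smul_apply, h2, h3, Pi.smul_apply, map_smul] }
  refine ⟨Λ₀.mkContinuous B fun u => ?_, fun u => (hmem u).coeFn_toLp⟩
  refine Lp.norm_le_mul_norm_of_ae_le_mul ?_
  filter_upwards [(hmem u).coeFn_toLp] with x hx
  change ‖((hmem u).toLp _ : L2 k) x‖ ≤ _
  rw [hx]
  exact (m x).le_of_opNorm_le (hB x) _

theorem exists_mulOp_real (h : R3 → ℝ) (hh : Continuous h) (ch : HasCompactSupport h) :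
    ∃ Λ : L2 k →L[ℂ] L2 k, ∀ u : L2 k, Λ u =ᵐ[volume] fun x => h x • u x := by
  obtain ⟨Λ, hΛ⟩ := exists_mulOp (k := k) (fun x => h x • ContinuousLinearMap.id ℂ (Cn k))
    (by fun_prop) (HasCompactSupport.intro ch fun x hx => by
      rw [image_eq_zero_of_notMem_tsupport hx]
      exact zero_smul ℝ (ContinuousLinearMap.id ℂ (Cn k)))
  refine ⟨Λ, fun u => (hΛ u).trans (ae_of_all _ fun x => ?_)⟩
  simp only [_root_.smul_apply, ContinuousLinearMap.id_apply]

namespace FirstOrder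

/-- The commutator `[𝒜·∇ + ℬ, h] = 𝒜·∇h`. -/
noncomputable def symb (a : FirstOrder k) (h : R3 → ℝ) (x : R3) : Cn k →L[ℂ] Cn k :=
  ∑ j, fderiv ℝ h x (EuclideanSpace.single j 1) • a.princ x j

theorem act_smul_real (a : FirstOrder k) {h : R3 → ℝ} {ψ : R3 → Cn k} (hh : ContDiff ℝ ∞ h)
    (hψ : ContDiff ℝ ∞ ψ) (x : R3) :
    a.act (fun y => h y • ψ y) x = h x • a.act ψ x + a.symb h x (ψ x) := by
  have h1 : DifferentiableAt ℝ ψ x := (hψ.differentiable (by simp)) x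
  have h2 : DifferentiableAt ℝ h x := (hh.differentiable (by simp)) x
  simp only [act, symb, fderiv_fun_smul h2 h1, _root_.add_apply, _root_.smul_apply,
    ContinuousLinearMap.smulRight_apply, map_add, ContinuousLinearMap.map_smul_of_tower,
    Finset.sum_add_distrib, smul_add, Finset.smul_sum, _root_.sum_apply]
  abel

theorem symb_continuous (a : FirstOrder k) {h : R3 → ℝ} (hh : ContDiff ℝ ∞ h) :
    Continuous (a.symb h) := by
  have h1 : ∀ j, Continuous fun x => a.princ x j := fun j =>
    (continuous_apply j).comp a.smooth_princ.continuous
  have h2 : ∀ v, Continuous fun x => fderiv ℝ h x v := fun v =>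
    (hh.continuous_fderiv (by simp)).clm_apply continuous_const
  exact continuous_finsetSum _ fun j _ => (h2 _).smul (h1 j)

theorem symb_eq_zero (a : FirstOrder k) {h : R3 → ℝ} {x : R3} (hx : fderiv ℝ h x = 0) :
    a.symb h x = 0 := by
  refine Finset.sum_eq_zero fun j _ => ?_
  rw [hx]
  exact zero_smul ℝ (a.princ x j)

theorem symb_hasCompactSupport (a : FirstOrder k) {h : R3 → ℝ} (ch : HasCompactSupport h) :
    HasCompactSupport (a.symb h) :=
  HasCompactSupport.intro ch fun _ hx => a.symb_eq_zero <|
    image_eq_zero_of_notMem_tsupport fun h' => hx (tsupport_fderiv_subset ℝ h')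

theorem norm_symb_le (a : FirstOrder k) {h : R3 → ℝ} {x : R3} {c₀ D : ℝ}
    (ha : ‖a.princ x‖ ≤ c₀) (hD : ‖fderiv ℝ h x‖ ≤ D) : ‖a.symb h x‖ ≤ 3 * c₀ * D := by
  have hc : 0 ≤ c₀ := (norm_nonneg _).trans ha
  refine (norm_sum_le_of_le _ (f := fun j => fderiv ℝ h x (EuclideanSpace.single j 1) • a.princ x j)
    (n := fun _ => c₀ * D) fun j _ => ?_).trans (by simp; linarith)
  rw [norm_smul, mul_comm]
  refine mul_le_mul ((norm_le_pi_norm _ j).trans ha) ?_ (norm_nonneg _) hc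
  refine ((fderiv ℝ h x).le_opNorm _).trans ?_
  simpa using hD

/-- In the energy identity this leaves one factor θ in the cross term, to be absorbed together with
Az. -/
theorem symb_mul_self (a : FirstOrder k) {h : R3 → ℝ} (hh : ContDiff ℝ ∞ h) (x : R3) :
    a.symb (fun y => h y ^ 2) x = (2 * h x) • a.symb h x := by
  have h2 : DifferentiableAt ℝ h x := (hh.differentiable (by simp)) x
  simp only [symb, Finset.smul_sum, fderiv_fun_pow 2 h2]
  refine Finset.sum_congr rfl fun j _ => ?_
  rw [smul_smul]
  simp

/-- **Localization**: multiplication by a smooth compactly supported function `h` maps the domain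
of one operator to the domain of another one with the same coefficients on the support of `h`. -/
theorem smul_mem_closedGraph {a a' : FirstOrder k} {h : R3 → ℝ} (hh : ContDiff ℝ ∞ h)
    (ch : HasCompactSupport h)
    (haa : ∀ x ∈ tsupport h, a'.princ x = a.princ x ∧ a'.pot x = a.pot x)
    {u w u' w' : L2 k} (hu : (u, w) ∈ a'.closedGraph) (hu' : u' =ᵐ[volume] fun x => h x • u x)
    (hw' : w' =ᵐ[volume] fun x => h x • w x + a.symb h x (u x)) : (u', w') ∈ a.closedGraph := by
  obtain ⟨Λ, hΛ⟩ := exists_mulOp_real (k := k) h hh.continuous ch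
  obtain ⟨Γ, hΓ⟩ := exists_mulOp (a.symb h) (a.symb_continuous hh) (a.symb_hasCompactSupport ch)
  have e1 : u' = Λ u := Lp.ext (hu'.trans (hΛ u).symm)
  have e2 : w' = Λ w + Γ u := by
    refine Lp.ext ?_
    filter_upwards [hw', hΛ w, hΓ u, Lp.coeFn_add (Λ w) (Γ u)] with x h1 h2 h3 h4
    rw [h1, h4, Pi.add_apply, h2, h3]
  rw [e1, e2]
  -- The bounded map Φ(u, w) = (hu, hw + [A,h]u) sends the core of `a'` into the core of `a` by the
  -- product rule, hence the closure into the closure.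
  let Φ : L2 k × L2 k → L2 k × L2 k := fun p => (Λ p.1, Λ p.2 + Γ p.1)
  have hΦ : Continuous Φ := by fun_prop
  refine map_mem_closure (f := Φ) hΦ hu ?_
  rintro ⟨p, q⟩ ⟨ψ, hψ, cψ, h1, h2⟩
  refine ⟨fun y => h y • ψ y, hh.smul hψ, ch.smul_right, ?_, ?_⟩
  · filter_upwards [hΛ p, h1] with x e1 e2
    rw [e1, e2]
  · filter_upwards [hΛ q, hΓ p, h1, h2, Lp.coeFn_add (Λ q) (Γ p)] with x e1 e2 e3 e4 e5
    change (Λ q + Γ p : L2 k) x = _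
    rw [e5, Pi.add_apply, e1, e2, a.act_smul_real hh hψ]
    rw [e3, e4]
    by_cases hx : x ∈ tsupport h
    · simp only [act, (haa x hx).1, (haa x hx).2]
    · rw [image_eq_zero_of_notMem_tsupport hx, zero_smul, zero_smul]

end FirstOrder

/-- A smooth cutoff function at scale `r`, equal to `1` on `B(x, 13r/4)` and supported in
`B(x, 15r/4)`, with a universal gradient bound. -/
theorem exists_cutoff : ∃ D : ℝ, 0 < D ∧ ∀ (x : R3) (r : ℝ), 0 < r → ∃ h : R3 → ℝ,
    ContDiff ℝ ∞ h ∧ HasCompactSupport h ∧ (∀ y, h y ∈ Icc (0 : ℝ) 1) ∧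
    (∀ y ∈ closedBall x r, h y = 1) ∧ tsupport h ⊆ closedBall x (4 * r) ∧
    (∀ y, ‖fderiv ℝ h y‖ ≤ D * r⁻¹) ∧
    ∀ y, fderiv ℝ h y ≠ 0 → y ∈ closedBall x (4 * r) \ closedBall x (3 * r) := by
  -- The radii 13/4 and 15/4 lie strictly between 3 and 4, so the gradient vanishes on the whole
  -- closed ball of radius 3r and the support stays inside radius 4r. The given χᵢ would not do: its
  -- gradient lies where φᵢ need not equal 1.
  let b : ContDiffBump (0 : R3) := ⟨13 / 4, 15 / 4, by norm_num, by norm_num⟩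
  have hb : ContDiff ℝ ∞ b := b.contDiff
  have cb : HasCompactSupport b := b.hasCompactSupport
  obtain ⟨D, hD⟩ := (cb.fderiv (𝕜 := ℝ)).exists_bound_of_continuous
    (hb.continuous_fderiv (by simp))
  have hD0 : 0 ≤ D := (norm_nonneg _).trans (hD 0)
  refine ⟨D + 1, by linarith, fun x r hr => ?_⟩
  let σ : R3 → R3 := fun y => r⁻¹ • (y - x)
  have hσ : ContDiff ℝ ∞ σ := (contDiff_id.sub contDiff_const).const_smul r⁻¹
  have nσ : ∀ y, ‖σ y‖ = r⁻¹ * ‖y - x‖ := fun y => by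
    simp [σ, norm_smul, abs_of_pos hr]
  have hsupp : tsupport (fun y => b (σ y)) ⊆ closedBall x (15 / 4 * r) := by
    refine closure_minimal (fun y hy => ?_) isClosed_closedBall
    have h1 : σ y ∈ Function.support b := hy
    rw [b.support_eq, mem_ball_zero_iff, nσ, inv_mul_lt_iff₀ hr] at h1
    rw [mem_closedBall_iff_norm]
    change ‖y - x‖ < r * (15 / 4) at h1
    linarith
  have hd : ∀ y, fderiv ℝ (fun y => b (σ y)) y = r⁻¹ • fderiv ℝ b (σ y) := by
    intro y
    have h1 : HasFDerivAt σ (r⁻¹ • ContinuousLinearMap.id ℝ R3) y :=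
      ((hasFDerivAt_id y).sub_const x).const_smul r⁻¹
    have h2 := ((hb.differentiable (by simp)) (σ y)).hasFDerivAt.comp y h1
    rw [show (fun y => b (σ y)) = b ∘ σ from rfl, h2.fderiv]
    ext v
    simp
  refine ⟨fun y => b (σ y), hb.comp hσ, ?_, fun y => ⟨b.nonneg, b.le_one⟩, ?_, ?_, ?_, ?_⟩
  · exact HasCompactSupport.of_support_subset_isCompact (isCompact_closedBall x (15 / 4 * r))
      ((subset_tsupport _).trans hsupp)
  · intro y hy
    refine b.one_of_mem_closedBall ?_
    rw [mem_closedBall_zero_iff, nσ, inv_mul_le_iff₀ hr]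
    rw [mem_closedBall_iff_norm] at hy
    change _ ≤ r * (13 / 4)
    linarith
  · exact hsupp.trans (closedBall_subset_closedBall (by linarith))
  · intro y
    rw [hd, norm_smul, Real.norm_of_nonneg (by positivity), mul_comm]
    gcongr
    linarith [hD (σ y)]
  · intro y hy
    have hy1 : y ∈ tsupport (fun y => b (σ y)) := by
      by_contra h
      exact hy (image_eq_zero_of_notMem_tsupport fun h' => h (tsupport_fderiv_subset ℝ h'))
    refine ⟨hsupp.trans (closedBall_subset_closedBall (by linarith)) hy1, fun hy2 => hy ?_⟩
    rw [mem_closedBall_iff_norm] at hy2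
    have h1 : σ y ∈ ball (0 : R3) b.rIn := by
      rw [mem_ball_zero_iff, nσ, inv_mul_lt_iff₀ hr]
      change _ < r * (13 / 4)
      linarith
    rw [hd, (b.eventuallyEq_one_of_mem_ball h1).fderiv_eq]
    simp


/-! ### Local and weighted energy estimates -/

/-- The positive and negative parts of `Φ` have equal finite integrals and cancel. Neither `L` nor
`B` has to be integrable or even measurable, so finiteness can be postponed to the absorption step.
-/
theorem lintegral_le_of_integral_eq_zero {α : Type*} [MeasurableSpace α] {ν : Measure α}
    {Φ L B : α → ℝ} (hΦ : Integrable Φ ν) (h0 : ∫ x, Φ x ∂ν = 0) (hL : ∀ x, 0 ≤ L x)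
    (hB : ∀ x, 0 ≤ B x) (h : ∀ᵐ x ∂ν, L x ≤ Φ x + B x) :
    ∫⁻ x, ENNReal.ofReal (L x) ∂ν ≤ ∫⁻ x, ENNReal.ofReal (B x) ∂ν := by
  have hm : AEMeasurable Φ ν := hΦ.aestronglyMeasurable.aemeasurable
  have hfin : ∫⁻ x, ENNReal.ofReal (Φ x) ∂ν ≠ ⊤ := hΦ.lintegral_lt_top.ne
  have hfin' : ∫⁻ x, ENNReal.ofReal (-Φ x) ∂ν ≠ ⊤ := hΦ.neg.lintegral_lt_top.ne
  have heq : ∫⁻ x, ENNReal.ofReal (Φ x) ∂ν = ∫⁻ x, ENNReal.ofReal (-Φ x) ∂ν := by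
    rw [integral_eq_lintegral_pos_part_sub_lintegral_neg_part hΦ, sub_eq_zero] at h0
    exact (ENNReal.toReal_eq_toReal_iff' hfin hfin').1 h0
  have hm' : AEMeasurable (fun x => -Φ x) ν := hm.neg
  have key : ∫⁻ x, ENNReal.ofReal (L x) ∂ν + ∫⁻ x, ENNReal.ofReal (-Φ x) ∂ν ≤
      ∫⁻ x, ENNReal.ofReal (B x) ∂ν + ∫⁻ x, ENNReal.ofReal (Φ x) ∂ν := by
    rw [← lintegral_add_right' _ hm'.ennreal_ofReal, ← lintegral_add_right' _ hm.ennreal_ofReal]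
    refine lintegral_mono_ae ?_
    filter_upwards [h] with x hx
    rcases le_total 0 (Φ x) with hp | hp
    · rw [ENNReal.ofReal_of_nonpos (neg_nonpos.2 hp), add_zero, ← ENNReal.ofReal_add (hB x) hp]
      exact ENNReal.ofReal_le_ofReal (by linarith)
    · rw [ENNReal.ofReal_of_nonpos hp, add_zero, ← ENNReal.ofReal_add (hL x) (by linarith)]
      exact ENNReal.ofReal_le_ofReal (by linarith)
  rw [heq] at key
  exact (ENNReal.add_le_add_iff_right hfin').1 key

theorem re_inner_smul_real_left {E : Type*} [NormedAddCommGroup E] [InnerProductSpace ℂ E] (r : ℝ)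
    (x y : E) : (⟪r • x, y⟫_ℂ).re = r * (⟪x, y⟫_ℂ).re := by
  rw [← Complex.coe_smul r x, inner_smul_left, Complex.conj_ofReal, Complex.re_ofReal_mul]

theorem re_inner_smul_real_right {E : Type*} [NormedAddCommGroup E] [InnerProductSpace ℂ E] (r : ℝ)
    (x y : E) : (⟪x, r • y⟫_ℂ).re = r * (⟪x, y⟫_ℂ).re := by
  rw [← Complex.coe_smul r y, inner_smul_right, Complex.re_ofReal_mul]

/-- With `w` = Az and `s` = [A,θ]z, the cross term 2t⟪s, w⟫ is at most ½t²|w|² + 2|s|². This costs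
half of |Az|² and nothing of W|z|². -/
theorem energy_pointwise {E : Type*} [NormedAddCommGroup E] [InnerProductSpace ℂ E] (t : ℝ)
    {W : ℝ} (hW : 0 ≤ W) (w s z q : E) :
    t ^ 2 * (1 / 2 * ‖w‖ ^ 2 + W * ‖z‖ ^ 2) ≤
      (⟪t ^ 2 • w + (2 * t) • s, w⟫_ℂ + ⟪t ^ 2 • √W • z, √W • z⟫_ℂ - ⟪t ^ 2 • z, q⟫_ℂ).re +
        (2 * ‖s‖ ^ 2 + t ^ 2 * (‖z‖ * ‖q‖)) := by
  have h1 : |(⟪s, w⟫_ℂ).re| ≤ ‖s‖ * ‖w‖ :=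
    (Complex.abs_re_le_norm _).trans (norm_inner_le_norm s w)
  have h2 : |(⟪z, q⟫_ℂ).re| ≤ ‖z‖ * ‖q‖ :=
    (Complex.abs_re_le_norm _).trans (norm_inner_le_norm z q)
  have h3 : ∀ y : E, (⟪y, y⟫_ℂ).re = ‖y‖ ^ 2 := fun y => inner_self_eq_norm_sq (𝕜 := ℂ) y
  rw [inner_add_left, Complex.sub_re, Complex.add_re, Complex.add_re]
  simp only [re_inner_smul_real_left, re_inner_smul_real_right, h3]
  have h4 : √W * (t ^ 2 * (√W * ‖z‖ ^ 2)) = t ^ 2 * (W * ‖z‖ ^ 2) := by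
    rw [mul_left_comm, ← mul_assoc (√W), Real.mul_self_sqrt hW]
  have h5 : t ^ 2 * (⟪z, q⟫_ℂ).re ≤ t ^ 2 * (‖z‖ * ‖q‖) :=
    mul_le_mul_of_nonneg_left ((le_abs_self _).trans h2) (sq_nonneg t)
  have h6 : -(|t| * (‖s‖ * ‖w‖)) ≤ t * (⟪s, w⟫_ℂ).re := by
    refine neg_le_of_abs_le ?_
    rw [abs_mul]
    exact mul_le_mul_of_nonneg_left h1 (abs_nonneg t)
  rw [h4]
  nlinarith [sq_nonneg (|t| * ‖w‖ - 2 * ‖s‖), sq_abs t]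

/-- The local energy estimate. -/
theorem IsWeakSol.energy {a : FirstOrder k} {W : R3 → ℝ} (hW : ∀ x, 0 ≤ W x) {z w q : L2 k}
    (h : IsWeakSol a W z w q) {θ : R3 → ℝ} (hθ : ContDiff ℝ ∞ θ) (cθ : HasCompactSupport θ) :
    ∫⁻ x, ENNReal.ofReal (θ x ^ 2 * (1 / 2 * ‖w x‖ ^ 2 + W x * ‖z x‖ ^ 2)) ≤
      ∫⁻ x, ENNReal.ofReal (2 * ‖a.symb θ x (z x)‖ ^ 2 + θ x ^ 2 * (‖z x‖ * ‖q x‖)) := by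
  obtain ⟨h1, m, h2, h3⟩ := h
  have hθ2 : ContDiff ℝ ∞ fun x => θ x ^ 2 := hθ.pow 2
  have cθ2 : HasCompactSupport fun x => θ x ^ 2 :=
    cθ.comp_left (g := fun t : ℝ => t ^ 2) (by simp)
  obtain ⟨Λ, hΛ⟩ := exists_mulOp_real (k := k) _ hθ2.continuous cθ2
  obtain ⟨Γ, hΓ⟩ := exists_mulOp (a.symb fun x => θ x ^ 2) (a.symb_continuous hθ2)
    (a.symb_hasCompactSupport cθ2)
  have hw' : (Λ w + Γ z : L2 k) =ᵐ[volume] fun x => θ x ^ 2 • w x +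
      a.symb (fun x => θ x ^ 2) x (z x) := by
    filter_upwards [hΛ w, hΓ z, Lp.coeFn_add (Λ w) (Γ z)] with x e1 e2 e3
    rw [e3, Pi.add_apply, e1, e2]
  -- The test vector is θ²z. The real part of the resulting pointwise identity has integral zero.
  have g1 : (Λ z, Λ w + Γ z) ∈ a.closedGraph :=
    FirstOrder.smul_mem_closedGraph hθ2 cθ2 (fun _ _ => ⟨rfl, rfl⟩) h1 (hΛ z) hw'
  have g2 : (Λ z, Λ m) ∈ mulGraph k fun x => √(W x) := by
    rw [mem_mulGraph] at h2 ⊢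
    filter_upwards [hΛ z, hΛ m, h2] with x e1 e2 e3
    rw [e1, e2, e3, smul_comm]
  have key := h3 _ _ _ g1 g2
  rw [L2.inner_def, L2.inner_def, L2.inner_def, ← sub_eq_zero,
    ← integral_add (L2.integrable_inner _ _) (L2.integrable_inner _ _),
    ← integral_sub ((L2.integrable_inner _ _).add (L2.integrable_inner _ _))
      (L2.integrable_inner _ _)] at key
  have hint := (((L2.integrable_inner (𝕜 := ℂ) (Λ w + Γ z) w).add
    (L2.integrable_inner (𝕜 := ℂ) (Λ m) m)).sub (L2.integrable_inner (𝕜 := ℂ) (Λ z) q))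
  refine lintegral_le_of_integral_eq_zero hint.re ?_ (fun x => ?_) (fun x => ?_) ?_
  · rw [integral_re hint]
    exact (congrArg Complex.re key).trans Complex.zero_re
  · exact mul_nonneg (sq_nonneg _) (add_nonneg (by positivity) (mul_nonneg (hW x) (sq_nonneg _)))
  · positivity
  · filter_upwards [hw', hΛ z, hΛ m, mem_mulGraph.1 h2] with x e1 e2 e3 e4
    simp only [Pi.add_apply, Pi.sub_apply]
    rw [e1, e2, e3, e4, a.symb_mul_self hθ]
    exact energy_pointwise (θ x) (hW x) (w x) (a.symb θ x (z x)) (z x) (q x)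


/-- A smooth quadratic partition of unity subordinate to sets with bounded overlap. -/
structure IsLocalization {ι : Type} (N : ℕ) (B : ι → Set R3) (θ : ι → R3 → ℝ) : Prop where
  smooth : ∀ i, ContDiff ℝ ∞ (θ i)
  compact : ∀ i, HasCompactSupport (θ i)
  supp : ∀ i, tsupport (θ i) ⊆ B i
  hasSum : ∀ y, HasSum (fun i => θ i y ^ 2) 1
  measurableSet : ∀ i, MeasurableSet (B i)
  overlap : ∀ y, ∑' i, (B i).indicator (fun _ => (1 : ℝ≥0∞)) y ≤ N + 1

theorem IsLocalization.tsum_mul {ι : Type} {N : ℕ} {B : ι → Set R3} {θ : ι → R3 → ℝ}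
    (h : IsLocalization N B θ) (y : R3) {r : ℝ} (hr : 0 ≤ r) :
    ∑' i, ENNReal.ofReal (θ i y ^ 2 * r) = ENNReal.ofReal r := by
  rw [← ENNReal.ofReal_tsum_of_nonneg (fun i => mul_nonneg (sq_nonneg _) hr)
    ((h.hasSum y).mul_right r).summable, ((h.hasSum y).mul_right r).tsum_eq, one_mul]

/-- The weighted energy estimate for slowly varying weights, with the localization error. -/
theorem IsWeakSol.weighted_energy {a : FirstOrder k} {W : R3 → ℝ} (mW : Measurable W)
    (hW : ∀ x, 0 ≤ W x) {z w q : L2 k} (h : IsWeakSol a W z w q) {ι : Type} [Countable ι] {N : ℕ}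
    {B : ι → Set R3} {θ : ι → R3 → ℝ} (hθ : IsLocalization N B θ) {κ : ℝ} (hκ : 0 ≤ κ)
    (hs : ∀ i, ∀ y ∈ B i, ‖a.symb (θ i) y‖ ^ 2 ≤ κ * W y) {τ : R3 → ℝ} (mτ : Measurable τ)
    {t : ι → ℝ} (h1 : ∀ i, ∀ y ∈ B i, τ y ^ 2 ≤ 16 * t i ^ 2)
    (h2 : ∀ i, ∀ y ∈ B i, t i ^ 2 ≤ 16 * τ y ^ 2) :
    ∫⁻ x, ENNReal.ofReal (τ x ^ 2 * (1 / 2 * ‖w x‖ ^ 2 + W x * ‖z x‖ ^ 2)) ≤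
      ∫⁻ x, ENNReal.ofReal (512 * κ * (N + 1) * (τ x ^ 2 * (W x * ‖z x‖ ^ 2)) +
        256 * (τ x ^ 2 * (‖z x‖ * ‖q x‖))) := by
  have mz : AEMeasurable (fun x => ‖z x‖) (volume : Measure R3) :=
    (Lp.aestronglyMeasurable z).norm.aemeasurable
  have mw : AEMeasurable (fun x => ‖w x‖) (volume : Measure R3) :=
    (Lp.aestronglyMeasurable w).norm.aemeasurable
  have mq : AEMeasurable (fun x => ‖q x‖) (volume : Measure R3) :=
    (Lp.aestronglyMeasurable q).norm.aemeasurable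
  have mθ : ∀ i, Measurable (θ i) := fun i => (hθ.smooth i).continuous.measurable
  have hL : ∀ x, 0 ≤ 1 / 2 * ‖w x‖ ^ 2 + W x * ‖z x‖ ^ 2 := fun x =>
    add_nonneg (by positivity) (mul_nonneg (hW x) (sq_nonneg _))
  have hz0 : ∀ i, ∀ y ∉ B i, θ i y = 0 := fun i y hy =>
    image_eq_zero_of_notMem_tsupport fun h' => hy (hθ.supp i h')
  have hs0 : ∀ i, ∀ y ∉ B i, a.symb (θ i) y = 0 := fun i y hy => a.symb_eq_zero <|
    image_eq_zero_of_notMem_tsupport fun h' => hy (hθ.supp i (tsupport_fderiv_subset ℝ h'))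
  -- The weight τ is not differentiable, so it is replaced by the constant `t i` on the support of
  -- θᵢ, at the price of a factor 16, and τ is restored afterwards at the price of another 16. Hence
  -- 256 = 16·16 and 512 = 2·16·16. The commutator term is only known to be supported in `B i`, so
  -- its sum costs the overlap N + 1; the source term carries θᵢ² and sums without loss.
  have step : ∀ i, ∫⁻ x, ENNReal.ofReal (θ i x ^ 2 * (τ x ^ 2 *
      (1 / 2 * ‖w x‖ ^ 2 + W x * ‖z x‖ ^ 2))) ≤
      ∫⁻ x, ((B i).indicator (fun _ => (1 : ℝ≥0∞)) x *
        ENNReal.ofReal (512 * κ * (τ x ^ 2 * (W x * ‖z x‖ ^ 2))) +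
        ENNReal.ofReal (θ i x ^ 2 * (256 * (τ x ^ 2 * (‖z x‖ * ‖q x‖))))) := by
    intro i
    calc ∫⁻ x, ENNReal.ofReal (θ i x ^ 2 * (τ x ^ 2 *
          (1 / 2 * ‖w x‖ ^ 2 + W x * ‖z x‖ ^ 2)))
        ≤ ∫⁻ x, ENNReal.ofReal (16 * t i ^ 2) * ENNReal.ofReal (θ i x ^ 2 *
          (1 / 2 * ‖w x‖ ^ 2 + W x * ‖z x‖ ^ 2)) := by
          refine lintegral_mono fun x => ?_
          simp only
          rw [← ENNReal.ofReal_mul (by positivity)]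
          refine ENNReal.ofReal_le_ofReal ?_
          by_cases hx : x ∈ B i
          · rw [mul_left_comm]
            exact mul_le_mul_of_nonneg_right (h1 i x hx) (mul_nonneg (sq_nonneg _) (hL x))
          · simp [hz0 i x hx]
      _ = ENNReal.ofReal (16 * t i ^ 2) * ∫⁻ x, ENNReal.ofReal (θ i x ^ 2 *
          (1 / 2 * ‖w x‖ ^ 2 + W x * ‖z x‖ ^ 2)) :=
          lintegral_const_mul' _ _ ENNReal.ofReal_ne_top
      _ ≤ ENNReal.ofReal (16 * t i ^ 2) * ∫⁻ x, ENNReal.ofReal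
          (2 * ‖a.symb (θ i) x (z x)‖ ^ 2 + θ i x ^ 2 * (‖z x‖ * ‖q x‖)) :=
          mul_le_mul_right (h.energy hW (hθ.smooth i) (hθ.compact i)) _
      _ = ∫⁻ x, ENNReal.ofReal (16 * t i ^ 2) * ENNReal.ofReal
          (2 * ‖a.symb (θ i) x (z x)‖ ^ 2 + θ i x ^ 2 * (‖z x‖ * ‖q x‖)) :=
          (lintegral_const_mul' _ _ ENNReal.ofReal_ne_top).symm
      _ ≤ _ := by
          refine lintegral_mono fun x => ?_
          simp only
          rw [← ENNReal.ofReal_mul (by positivity)]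
          by_cases hx : x ∈ B i
          · rw [indicator_of_mem hx, one_mul, ← ENNReal.ofReal_add
              (mul_nonneg (by positivity) (mul_nonneg (sq_nonneg _)
                (mul_nonneg (hW x) (sq_nonneg _)))) (by positivity)]
            refine ENNReal.ofReal_le_ofReal ?_
            have e1 : ‖a.symb (θ i) x (z x)‖ ^ 2 ≤ κ * W x * ‖z x‖ ^ 2 := by
              refine (pow_le_pow_left₀ (norm_nonneg _)
                ((a.symb (θ i) x).le_opNorm (z x)) 2).trans ?_
              rw [mul_pow]
              exact mul_le_mul_of_nonneg_right (hs i x hx) (sq_nonneg _)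
            have e2 := h2 i x hx
            have e3 : 0 ≤ κ * W x * ‖z x‖ ^ 2 := by have := hW x; positivity
            have e4 : 0 ≤ θ i x ^ 2 * (‖z x‖ * ‖q x‖) := by positivity
            calc 16 * t i ^ 2 * (2 * ‖a.symb (θ i) x (z x)‖ ^ 2 + θ i x ^ 2 * (‖z x‖ * ‖q x‖))
                ≤ 16 * (16 * τ x ^ 2) *
                  (2 * (κ * W x * ‖z x‖ ^ 2) + θ i x ^ 2 * (‖z x‖ * ‖q x‖)) := by gcongr
              _ = _ := by ring
          · simp [hz0 i x hx, hs0 i x hx]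
  calc ∫⁻ x, ENNReal.ofReal (τ x ^ 2 * (1 / 2 * ‖w x‖ ^ 2 + W x * ‖z x‖ ^ 2))
      = ∫⁻ x, ∑' i, ENNReal.ofReal (θ i x ^ 2 * (τ x ^ 2 *
          (1 / 2 * ‖w x‖ ^ 2 + W x * ‖z x‖ ^ 2))) :=
        lintegral_congr fun x => (hθ.tsum_mul x (mul_nonneg (sq_nonneg _) (hL x))).symm
    _ = ∑' i, ∫⁻ x, ENNReal.ofReal (θ i x ^ 2 * (τ x ^ 2 *
          (1 / 2 * ‖w x‖ ^ 2 + W x * ‖z x‖ ^ 2))) :=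
        lintegral_tsum fun i => by
          have := mθ i
          fun_prop
    _ ≤ ∑' i, ∫⁻ x, ((B i).indicator (fun _ => (1 : ℝ≥0∞)) x *
        ENNReal.ofReal (512 * κ * (τ x ^ 2 * (W x * ‖z x‖ ^ 2))) +
        ENNReal.ofReal (θ i x ^ 2 * (256 * (τ x ^ 2 * (‖z x‖ * ‖q x‖))))) :=
        ENNReal.tsum_le_tsum step
    _ = ∫⁻ x, ∑' i, ((B i).indicator (fun _ => (1 : ℝ≥0∞)) x *
        ENNReal.ofReal (512 * κ * (τ x ^ 2 * (W x * ‖z x‖ ^ 2))) +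
        ENNReal.ofReal (θ i x ^ 2 * (256 * (τ x ^ 2 * (‖z x‖ * ‖q x‖))))) := by
        refine (lintegral_tsum fun i => ?_).symm
        have := mθ i
        have m1 : Measurable ((B i).indicator (fun _ => (1 : ℝ≥0∞))) :=
          measurable_const.indicator (hθ.measurableSet i)
        fun_prop
    _ ≤ _ := by
        refine lintegral_mono fun x => ?_
        have e1 : 0 ≤ τ x ^ 2 * (W x * ‖z x‖ ^ 2) :=
          mul_nonneg (sq_nonneg _) (mul_nonneg (hW x) (sq_nonneg _))
        simp only
        rw [ENNReal.tsum_add, ENNReal.tsum_mul_right, hθ.tsum_mul x (by positivity),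
          ENNReal.ofReal_add (by positivity) (by positivity)]
        gcongr
        calc _ ≤ ((N : ℝ≥0∞) + 1) * ENNReal.ofReal (512 * κ * (τ x ^ 2 * (W x * ‖z x‖ ^ 2))) := by
              gcongr
              exact hθ.overlap x
          _ = _ := by
              have e2 : ((N : ℝ≥0∞) + 1) = ENNReal.ofReal (N + 1) := by
                rw [ENNReal.ofReal_add (by positivity) zero_le_one]
                simp
              rw [e2, ← ENNReal.ofReal_mul (by positivity)]
              congr 1
              ring

/-- The weighted energy estimate for a bounded weight with small localization error. -/
theorem IsWeakSol.weighted_energy_absorbed {a : FirstOrder k} {W : R3 → ℝ} (mW : Measurable W)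
    (hW : ∀ x, 0 ≤ W x) {z w q : L2 k} (h : IsWeakSol a W z w q) {ι : Type} [Countable ι] {N : ℕ}
    {B : ι → Set R3} {θ : ι → R3 → ℝ} (hθ : IsLocalization N B θ) {κ : ℝ} (hκ : 0 ≤ κ)
    (hκN : 512 * κ * (N + 1) ≤ 1 / 4)
    (hs : ∀ i, ∀ y ∈ B i, ‖a.symb (θ i) y‖ ^ 2 ≤ κ * W y) {τ : R3 → ℝ} (mτ : Measurable τ)
    (hτ : ∀ y, 0 ≤ τ y) {n : ℝ} (hτn : ∀ y, τ y ≤ n)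
    {t : ι → ℝ} (h1 : ∀ i, ∀ y ∈ B i, τ y ^ 2 ≤ 16 * t i ^ 2)
    (h2 : ∀ i, ∀ y ∈ B i, t i ^ 2 ≤ 16 * τ y ^ 2) {g : L2 k}
    (hg : ∀ᵐ y ∂(volume : Measure R3), τ y * ‖q y‖ ≤ √(W y) * ‖g y‖) :
    ∫⁻ x, ENNReal.ofReal (τ x ^ 2 * (‖w x‖ ^ 2 + W x * ‖z x‖ ^ 2)) ≤
      ∫⁻ x, ENNReal.ofReal (131072 * ‖g x‖ ^ 2) := by
  have mz : AEMeasurable (fun x => ‖z x‖) (volume : Measure R3) :=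
    (Lp.aestronglyMeasurable z).norm.aemeasurable
  have mw : AEMeasurable (fun x => ‖w x‖) (volume : Measure R3) :=
    (Lp.aestronglyMeasurable w).norm.aemeasurable
  have hpos : ∀ x, 0 ≤ τ x ^ 2 * (W x * ‖z x‖ ^ 2) := fun x =>
    mul_nonneg (sq_nonneg _) (mul_nonneg (hW x) (sq_nonneg _))
  have key := h.weighted_energy mW hW hθ hκ hs mτ h1 h2
  -- Absorption is legitimate only for a finite quantity; this is where boundedness of τ enters, as
  -- √W z is known to be in `L²`.
  have hfin : ∫⁻ x, ENNReal.ofReal (1 / 2 * (τ x ^ 2 * (W x * ‖z x‖ ^ 2))) ≠ ⊤ := by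
    obtain ⟨-, m, hm, -⟩ := h
    have hI : Integrable (fun x => n ^ 2 * ‖m x‖ ^ 2) (volume : Measure R3) :=
      ((Lp.memLp m).integrable_norm_pow (p := 2) (by norm_num)).const_mul _
    refine ne_top_of_le_ne_top hI.lintegral_lt_top.ne (lintegral_mono_ae ?_)
    filter_upwards [mem_mulGraph.1 hm] with x hx
    refine ENNReal.ofReal_le_ofReal ?_
    rw [hx, norm_smul, mul_pow, Real.norm_of_nonneg (Real.sqrt_nonneg _), Real.sq_sqrt (hW x)]
    have e1 : τ x ^ 2 * (W x * ‖z x‖ ^ 2) ≤ n ^ 2 * (W x * ‖z x‖ ^ 2) :=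
      mul_le_mul_of_nonneg_right (pow_le_pow_left₀ (hτ x) (hτn x) 2)
        (mul_nonneg (hW x) (sq_nonneg _))
    linarith [hpos x]
  have k1 : ∫⁻ x, ENNReal.ofReal (τ x ^ 2 * (1 / 2 * ‖w x‖ ^ 2 + W x * ‖z x‖ ^ 2)) ≤
      (∫⁻ x, ENNReal.ofReal (1 / 2 * (τ x ^ 2 * (W x * ‖z x‖ ^ 2)))) +
        ∫⁻ x, ENNReal.ofReal (65536 * ‖g x‖ ^ 2) := by
    refine key.trans ?_
    rw [← lintegral_add_left' (by fun_prop)]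
    refine lintegral_mono_ae ?_
    filter_upwards [hg] with x hx
    rw [← ENNReal.ofReal_add (by have := hpos x; positivity) (by positivity)]
    refine ENNReal.ofReal_le_ofReal ?_
    have e1 := mul_le_mul_of_nonneg_right hκN (hpos x)
    have e2 : τ x ^ 2 * (‖z x‖ * ‖q x‖) ≤ (τ x * √(W x) * ‖z x‖) * ‖g x‖ := by
      calc τ x ^ 2 * (‖z x‖ * ‖q x‖) = τ x * ‖z x‖ * (τ x * ‖q x‖) := by ring
        _ ≤ τ x * ‖z x‖ * (√(W x) * ‖g x‖) :=
          mul_le_mul_of_nonneg_left hx (mul_nonneg (hτ x) (norm_nonneg _))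
        _ = _ := by ring
    have e3 : (τ x * √(W x) * ‖z x‖) ^ 2 = τ x ^ 2 * (W x * ‖z x‖ ^ 2) := by
      rw [mul_pow, mul_pow, Real.sq_sqrt (hW x), mul_assoc]
    -- With α = τ√W|z|, the source term satisfies 256 α|g| ≤ ¼α² + 65536|g|². Together with the ¼α²
    -- allowed by `hκN` this is half of the left-hand W|z|² term.
    nlinarith [sq_nonneg (τ x * √(W x) * ‖z x‖ - 512 * ‖g x‖)]
  have k2 : ∫⁻ x, ENNReal.ofReal (τ x ^ 2 * (1 / 2 * ‖w x‖ ^ 2 + W x * ‖z x‖ ^ 2)) =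
      (∫⁻ x, ENNReal.ofReal (1 / 2 * (τ x ^ 2 * (W x * ‖z x‖ ^ 2)))) +
      ∫⁻ x, ENNReal.ofReal (1 / 2 * (τ x ^ 2 * (‖w x‖ ^ 2 + W x * ‖z x‖ ^ 2))) := by
    rw [← lintegral_add_left' (by fun_prop)]
    refine lintegral_congr fun x => ?_
    have e1 := hpos x
    have e2 := hW x
    rw [← ENNReal.ofReal_add (by positivity) (by positivity)]
    congr 1
    ring
  rw [k2] at k1
  have k3 := (ENNReal.add_le_add_iff_left hfin).1 k1
  have k4 : ∀ v : R3 → ℝ, ∫⁻ x, ENNReal.ofReal (2 * v x) =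
      ENNReal.ofReal 2 * ∫⁻ x, ENNReal.ofReal (v x) := fun v => by
    rw [← lintegral_const_mul' _ _ ENNReal.ofReal_ne_top]
    exact lintegral_congr fun x => ENNReal.ofReal_mul zero_le_two
  have k5 := mul_le_mul_right k3 (ENNReal.ofReal 2)
  rw [← k4, ← k4] at k5
  convert k5 using 4 <;> ring

/-- The weighted energy estimate for the weight `√W / F`. -/
theorem IsWeakSol.weighted_energy_final {a : FirstOrder k} {W F : R3 → ℝ} (mW : Measurable W)
    (hW : ∀ x, 0 < W x) (mF : Measurable F) (hF : ∀ x, 0 < F x) {z w q : L2 k}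
    (h : IsWeakSol a W z w q) {ι : Type} [Countable ι] {N : ℕ}
    {B : ι → Set R3} {θ : ι → R3 → ℝ} (hθ : IsLocalization N B θ) {κ : ℝ} (hκ : 0 ≤ κ)
    (hκN : 512 * κ * (N + 1) ≤ 1 / 4)
    (hs : ∀ i, ∀ y ∈ B i, ‖a.symb (θ i) y‖ ^ 2 ≤ κ * W y) {x : ι → R3}
    (hW1 : ∀ i, ∀ y ∈ B i, W y ≤ 4 * W (x i)) (hW2 : ∀ i, ∀ y ∈ B i, W (x i) ≤ 4 * W y)
    (hF1 : ∀ i, ∀ y ∈ B i, F y ≤ 2 * F (x i)) (hF2 : ∀ i, ∀ y ∈ B i, F (x i) ≤ 2 * F y)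
    {g : L2 k} (hg : ∀ᵐ y ∂(volume : Measure R3), ‖q y‖ ≤ F y * ‖g y‖) :
    ∫⁻ x, ENNReal.ofReal (W x / F x ^ 2 * (‖w x‖ ^ 2 + W x * ‖z x‖ ^ 2)) ≤
      ∫⁻ x, ENNReal.ofReal (131072 * ‖g x‖ ^ 2) := by
  have mz : AEMeasurable (fun x => ‖z x‖) (volume : Measure R3) :=
    (Lp.aestronglyMeasurable z).norm.aemeasurable
  have mw : AEMeasurable (fun x => ‖w x‖) (volume : Measure R3) :=
    (Lp.aestronglyMeasurable w).norm.aemeasurable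
  set σ : R3 → ℝ := fun y => √(W y) / F y with hσ
  have σ0 : ∀ y, 0 ≤ σ y := fun y => div_nonneg (Real.sqrt_nonneg _) (hF y).le
  have mσ : Measurable σ := mW.sqrt.div mF
  have sq4 : ∀ s t : ℝ, s ≤ 4 * t → √s ≤ 2 * √t := fun s t hst => by
    rw [show (2 : ℝ) * √t = √(4 * t) by
      rw [Real.sqrt_mul (by norm_num), show (4 : ℝ) = 2 ^ 2 by norm_num,
        Real.sqrt_sq (by norm_num)]]
    exact Real.sqrt_le_sqrt hst
  have ratio : ∀ y y', W y ≤ 4 * W y' → F y' ≤ 2 * F y → σ y ≤ 4 * σ y' := fun y y' e1 e2 => by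
    simp only [hσ]
    rw [← mul_div_assoc, div_le_div_iff₀ (hF y) (hF y')]
    have := Real.sqrt_nonneg (W y')
    calc √(W y) * F y' ≤ (2 * √(W y')) * (2 * F y) :=
          mul_le_mul (sq4 _ _ e1) e2 (hF y').le (by positivity)
      _ = _ := by ring
  -- Truncating the weight at a constant preserves its ratio bound: 2 from √W times 2 from F, hence
  -- 16 after squaring.
  have minr : ∀ (n : ℕ) (s t : ℝ), 0 ≤ s → 0 ≤ t → s ≤ 4 * t →
      min s n ^ 2 ≤ 16 * min t n ^ 2 := fun n s t hs ht hst => by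
    have hn : (0 : ℝ) ≤ n := n.cast_nonneg
    have e : min s n ≤ 4 * min t n := by
      rw [mul_min_of_nonneg _ _ (by norm_num : (0 : ℝ) ≤ 4)]
      exact le_min ((min_le_left _ _).trans hst) ((min_le_right _ _).trans (by linarith))
    have e' : 0 ≤ min s n := le_min hs hn
    nlinarith
  have bound : ∀ n : ℕ, ∫⁻ x, ENNReal.ofReal (min (σ x) n ^ 2 * (‖w x‖ ^ 2 + W x * ‖z x‖ ^ 2)) ≤
      ∫⁻ x, ENNReal.ofReal (131072 * ‖g x‖ ^ 2) := by
    intro n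
    refine h.weighted_energy_absorbed mW (fun x => (hW x).le) hθ hκ hκN hs (n := n)
      (t := fun i => min (σ (x i)) n) (mσ.min measurable_const)
      (fun y => le_min (σ0 y) n.cast_nonneg) (fun y => min_le_right _ _)
      (fun i y hy => minr n _ _ (σ0 _) (σ0 _) (ratio _ _ (hW1 i y hy) (hF2 i y hy)))
      (fun i y hy => minr n _ _ (σ0 _) (σ0 _) (ratio _ _ (hW2 i y hy) (hF1 i y hy))) ?_
    filter_upwards [hg] with y hy
    calc min (σ y) n * ‖q y‖ ≤ σ y * (F y * ‖g y‖) :=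
          mul_le_mul (min_le_left _ _) hy (norm_nonneg _) (σ0 y)
      _ = √(W y) * ‖g y‖ := by
          simp only [hσ]
          rw [← mul_assoc, div_mul_cancel₀ _ (hF y).ne']
  have hL : ∀ x, 0 ≤ ‖w x‖ ^ 2 + W x * ‖z x‖ ^ 2 := fun x =>
    add_nonneg (sq_nonneg _) (mul_nonneg (hW x).le (sq_nonneg _))
  -- The bound does not depend on the truncation level, so monotone convergence removes it.
  refine le_of_tendsto' (lintegral_tendsto_of_tendsto_of_monotone (f := fun (n : ℕ) x =>
    ENNReal.ofReal (min (σ x) n ^ 2 * (‖w x‖ ^ 2 + W x * ‖z x‖ ^ 2))) (fun n => by fun_prop)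
    (ae_of_all _ fun x n n' hn => ?_) (ae_of_all _ fun x => ?_)) bound
  · refine ENNReal.ofReal_le_ofReal (mul_le_mul_of_nonneg_right (pow_le_pow_left₀
      (le_min (σ0 x) n.cast_nonneg) (min_le_min_left _ (by exact_mod_cast hn)) 2) (hL x))
  · refine tendsto_const_nhds.congr' ?_
    obtain ⟨n₀, hn₀⟩ := exists_nat_ge (σ x)
    filter_upwards [Filter.eventually_ge_atTop n₀] with n hn
    rw [min_eq_left (hn₀.trans (by exact_mod_cast hn))]
    simp only [hσ]
    rw [div_pow, Real.sq_sqrt (hW x).le]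


/-! ### Pairing a global solution with a local source -/

theorem FirstOrder.symb_congr {a a' : FirstOrder k} {h : R3 → ℝ}
    (haa : ∀ x ∈ tsupport h, a'.princ x = a.princ x) : a'.symb h = a.symb h := by
  funext x
  by_cases hx : x ∈ tsupport h
  · simp only [FirstOrder.symb, haa x hx]
  · have : fderiv ℝ h x = 0 :=
      image_eq_zero_of_notMem_tsupport fun h' => hx (tsupport_fderiv_subset ℝ h')
    rw [a.symb_eq_zero this, a'.symb_eq_zero this]

/-- Compactly supported truncations of `L²` vectors satisfy the potential part of the form domain.
This makes hz and hu admissible in each other's equation although the potentials differ. -/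
theorem exists_mulGraph_sqrt {W : R3 → ℝ} (hW : IsPotential W) {h : R3 → ℝ}
    (ch : HasCompactSupport h) {C : ℝ} (hC : ∀ x, |h x| ≤ C)
    (u v : L2 k) (hv : v =ᵐ[volume] fun x => h x • u x) :
    ∃ m, (v, m) ∈ mulGraph k fun x => √(W x) := by
  obtain ⟨B, hB⟩ := hW.locally_bounded _ ch
  have hm : MemLp (fun x => √(W x) • v x) 2 (volume : Measure R3) := by
    refine (Lp.memLp u).of_le_mul (c := √B * C)
      (hW.measurable.sqrt.aestronglyMeasurable.smul (Lp.aestronglyMeasurable v)) ?_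
    filter_upwards [hv] with x hx
    rw [hx, norm_smul, norm_smul, Real.norm_of_nonneg (Real.sqrt_nonneg _), ← mul_assoc]
    refine mul_le_mul_of_nonneg_right ?_ (norm_nonneg _)
    by_cases h' : x ∈ tsupport h
    · exact mul_le_mul (Real.sqrt_le_sqrt (hB x h')) (hC x) (norm_nonneg _) (Real.sqrt_nonneg _)
    · rw [image_eq_zero_of_notMem_tsupport h', norm_zero, mul_zero]
      exact mul_nonneg (Real.sqrt_nonneg _) ((abs_nonneg _).trans (hC x))
  exact ⟨hm.toLp _, hm.coeFn_toLp⟩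

/-- The leading terms η⟪w, v⟫ cancel. What survives is η⟪q, u⟫ − (W−p)η⟪z, u⟫ − ⟪w, Su⟫ + ⟪Sz, v⟫,
with `S` the commutator with the cutoff. -/
theorem pairing_pointwise {E : Type*} [NormedAddCommGroup E] [InnerProductSpace ℂ E] {η p W : ℝ}
    (hη0 : 0 ≤ η) (hη1 : η ≤ 1) (hp : 0 ≤ p) (hW : 0 ≤ W) (S : E →L[ℂ] E) (z w q u v : E) :
    ‖⟪η • w + S z, v⟫_ℂ + ⟪√p • η • z, √p • u⟫_ℂ + ⟪q, η • u⟫_ℂ - ⟪w, η • v + S u⟫_ℂ -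
      ⟪√W • z, √W • η • u⟫_ℂ‖ ≤
      ‖q‖ * ‖u‖ + |W - p| * ‖z‖ * ‖u‖ + ‖S‖ * ‖w‖ * ‖u‖ + ‖S‖ * ‖z‖ * ‖v‖ := by
  have e : ⟪η • w + S z, v⟫_ℂ + ⟪√p • η • z, √p • u⟫_ℂ + ⟪q, η • u⟫_ℂ - ⟪w, η • v + S u⟫_ℂ -
      ⟪√W • z, √W • η • u⟫_ℂ = (η : ℂ) * ⟪q, u⟫_ℂ - ((W - p : ℝ) : ℂ) * η * ⟪z, u⟫_ℂ -
      ⟪w, S u⟫_ℂ + ⟪S z, v⟫_ℂ := by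
    have hp' : ((√p : ℝ) : ℂ) * (√p : ℝ) = p := by
      rw [← Complex.ofReal_mul, Real.mul_self_sqrt hp]
    have hW' : ((√W : ℝ) : ℂ) * (√W : ℝ) = W := by
      rw [← Complex.ofReal_mul, Real.mul_self_sqrt hW]
    simp only [← Complex.coe_smul, inner_add_left, inner_add_right, inner_smul_left,
      inner_smul_right, Complex.conj_ofReal]
    push_cast
    linear_combination η * ⟪z, u⟫_ℂ * hp' - η * ⟪z, u⟫_ℂ * hW'
  rw [e]
  have b1 : ‖(η : ℂ) * ⟪q, u⟫_ℂ‖ ≤ ‖q‖ * ‖u‖ := by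
    rw [norm_mul, Complex.norm_real, Real.norm_of_nonneg hη0]
    calc η * ‖⟪q, u⟫_ℂ‖ ≤ 1 * (‖q‖ * ‖u‖) :=
          mul_le_mul hη1 (norm_inner_le_norm q u) (norm_nonneg _) zero_le_one
      _ = _ := one_mul _
  have b2 : ‖((W - p : ℝ) : ℂ) * η * ⟪z, u⟫_ℂ‖ ≤ |W - p| * ‖z‖ * ‖u‖ := by
    rw [norm_mul, norm_mul, Complex.norm_real, Complex.norm_real, Real.norm_of_nonneg hη0,
      Real.norm_eq_abs, mul_assoc, mul_assoc]
    refine mul_le_mul_of_nonneg_left ?_ (abs_nonneg _)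
    calc η * ‖⟪z, u⟫_ℂ‖ ≤ 1 * (‖z‖ * ‖u‖) :=
          mul_le_mul hη1 (norm_inner_le_norm z u) (norm_nonneg _) zero_le_one
      _ = _ := one_mul _
  have b3 : ‖⟪w, S u⟫_ℂ‖ ≤ ‖S‖ * ‖w‖ * ‖u‖ := by
    refine (norm_inner_le_norm _ _).trans ?_
    calc ‖w‖ * ‖S u‖ ≤ ‖w‖ * (‖S‖ * ‖u‖) :=
          mul_le_mul_of_nonneg_left (S.le_opNorm u) (norm_nonneg _)
      _ = _ := by ring
  have b4 : ‖⟪S z, v⟫_ℂ‖ ≤ ‖S‖ * ‖z‖ * ‖v‖ := by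
    refine (norm_inner_le_norm _ _).trans ?_
    exact mul_le_mul_of_nonneg_right (S.le_opNorm z) (norm_nonneg _)
  refine (norm_add_le _ _).trans ?_
  refine (add_le_add ((norm_sub_le _ _).trans (add_le_add ((norm_sub_le _ _).trans
    (add_le_add b1 b2)) b3)) b4).trans le_rfl

/-- Pairing of a global solution with the source of a local problem. -/
theorem IsWeakSol.enorm_inner_le {a a' : FirstOrder k} {W : R3 → ℝ} (hW : IsPotential W)
    {z w q : L2 k} (hz : IsWeakSol a W z w q) {p : ℝ} (hp : 0 ≤ p) {u v b : L2 k}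
    (hu : IsWeakSol a' (fun _ => p) u v b) {h : R3 → ℝ} (hh : ContDiff ℝ ∞ h)
    (ch : HasCompactSupport h) (rh : ∀ y, h y ∈ Icc (0 : ℝ) 1)
    (haa : ∀ x ∈ tsupport h, a'.princ x = a.princ x ∧ a'.pot x = a.pot x)
    (hb : ∀ᵐ x ∂(volume : Measure R3), h x ≠ 1 → b x = 0) :
    ‖⟪z, b⟫_ℂ‖ₑ ≤ ∫⁻ x, (tsupport h).indicator (fun _ => 1) x * ENNReal.ofReal
      (‖q x‖ * ‖u x‖ + |W x - p| * ‖z x‖ * ‖u x‖ + ‖a.symb h x‖ * ‖w x‖ * ‖u x‖ +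
        ‖a.symb h x‖ * ‖z x‖ * ‖v x‖) := by
  obtain ⟨z1, m, z2, z3⟩ := hz
  obtain ⟨u1, n, u2, u3⟩ := hu
  obtain ⟨Λ, hΛ⟩ := exists_mulOp_real (k := k) h hh.continuous ch
  obtain ⟨Γ, hΓ⟩ := exists_mulOp (a.symb h) (a.symb_continuous hh) (a.symb_hasCompactSupport ch)
  have hsum : ∀ s t : L2 k, (Λ s + Γ t : L2 k) =ᵐ[volume] fun x => h x • s x +
      a.symb h x (t x) := fun s t => by
    filter_upwards [hΛ s, hΓ t, Lp.coeFn_add (Λ s) (Γ t)] with x e1 e2 e3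
    rw [e3, Pi.add_apply, e1, e2]
  have g1 : (Λ z, Λ w + Γ z) ∈ a'.closedGraph := by
    refine FirstOrder.smul_mem_closedGraph hh ch
      (fun x hx => ⟨(haa x hx).1.symm, (haa x hx).2.symm⟩) z1 (hΛ z) ?_
    rw [FirstOrder.symb_congr fun x hx => (haa x hx).1]
    exact hsum w z
  have g2 : (Λ u, Λ v + Γ u) ∈ a.closedGraph :=
    FirstOrder.smul_mem_closedGraph hh ch haa u1 (hΛ u) (hsum v u)
  have ha : ∀ x, |h x| ≤ 1 := fun x => by
    rw [abs_of_nonneg (rh x).1]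
    exact (rh x).2
  have hcp : IsPotential fun _ : R3 => p := ⟨measurable_const, fun _ => hp, fun _ _ =>
    ⟨p, fun _ _ => le_rfl⟩⟩
  obtain ⟨n', hn'⟩ := exists_mulGraph_sqrt hcp ch ha z (Λ z) (hΛ z)
  obtain ⟨m', hm'⟩ := exists_mulGraph_sqrt hW ch ha u (Λ u) (hΛ u)
  have k1 := u3 _ _ _ g1 hn'
  have k2 := z3 _ _ _ g2 hm'
  have k3 := congrArg (starRingEnd ℂ) k2
  rw [map_add, inner_conj_symm, inner_conj_symm, inner_conj_symm] at k3
  -- The cutoff may be inserted for free, since `b` vanishes wherever h ≠ 1.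
  have k4 : ⟪z, b⟫_ℂ = ⟪Λ z, b⟫_ℂ := by
    rw [L2.inner_def, L2.inner_def]
    refine integral_congr_ae ?_
    filter_upwards [hΛ z, hb] with x e1 e2
    rw [e1]
    by_cases hx : h x = 1
    · rw [hx, one_smul]
    · rw [e2 hx, inner_zero_right, inner_zero_right]
  have k5 : ⟪z, b⟫_ℂ = ⟪Λ w + Γ z, v⟫_ℂ + ⟪n', n⟫_ℂ + ⟪q, Λ u⟫_ℂ - ⟪w, Λ v + Γ u⟫_ℂ -
      ⟪m, m'⟫_ℂ := by
    rw [k4, ← k1, ← k3]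
    ring
  rw [k5]
  have i : ∀ s t : L2 k, Integrable (fun x => ⟪s x, t x⟫_ℂ) (volume : Measure R3) :=
    fun s t => L2.integrable_inner s t
  simp only [L2.inner_def]
  rw [← integral_add' (i _ _) (i _ _), ← integral_add' ((i _ _).add (i _ _)) (i _ _),
    ← integral_sub' (((i _ _).add (i _ _)).add (i _ _)) (i _ _),
    ← integral_sub' ((((i _ _).add (i _ _)).add (i _ _)).sub (i _ _)) (i _ _)]
  refine (enorm_integral_le_lintegral_enorm _).trans (lintegral_mono_ae ?_)
  filter_upwards [hsum w z, hsum v u, mem_mulGraph.1 hn', mem_mulGraph.1 u2, hΛ u,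
    mem_mulGraph.1 z2, mem_mulGraph.1 hm', hΛ z] with x e1 e2 e3 e4 e5 e6 e7 e8
  simp only [Pi.add_apply, Pi.sub_apply]
  rw [e1, e2, e3, e4, e5, e6, e7, e5, e8]
  by_cases hx : x ∈ tsupport h
  · rw [indicator_of_mem hx, one_mul, ← ofReal_norm]
    exact ENNReal.ofReal_le_ofReal (pairing_pointwise (rh x).1 (rh x).2 hp (hW.nonneg x) _ _ _ _ _ _)
  · have h0 : h x = 0 := image_eq_zero_of_notMem_tsupport hx
    have h1 : a.symb h x = 0 := a.symb_eq_zero <|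
      image_eq_zero_of_notMem_tsupport fun h' => hx (tsupport_fderiv_subset ℝ h')
    rw [h0, h1]
    simp

/-- Pairing bound in terms of weighted quantities. -/
theorem IsWeakSol.enorm_inner_le_weighted {a a' : FirstOrder k} {W F : R3 → ℝ}
    (hW : IsPotential W) (hF : ∀ x, 0 < F x)
    {z w q g : L2 k} (hz : IsWeakSol a W z w q) {p : ℝ} (hp : 0 < p) {u v b : L2 k}
    (hu : IsWeakSol a' (fun _ => p) u v b) {h : R3 → ℝ} (hh : ContDiff ℝ ∞ h)
    (ch : HasCompactSupport h) (rh : ∀ y, h y ∈ Icc (0 : ℝ) 1)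
    (haa : ∀ x ∈ tsupport h, a'.princ x = a.princ x ∧ a'.pot x = a.pot x)
    (hb : ∀ᵐ x ∂(volume : Measure R3), h x ≠ 1 → b x = 0)
    (hg : ∀ᵐ y ∂(volume : Measure R3), ‖q y‖ ≤ F y * ‖g y‖) {D : Set R3} (hD : tsupport h ⊆ D)
    {F₀ : ℝ} (hF₀ : ∀ y ∈ D, F y ≤ 2 * F₀) (hWp : ∀ y ∈ D, p ≤ 4 * W y)
    (hs : ∀ y ∈ D, ‖a.symb h y‖ ^ 2 ≤ W y) {φ : R3 → ℝ}
    (hφ : ∀ y, fderiv ℝ h y ≠ 0 → φ y = 1) :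
    ‖⟪z, b⟫_ℂ‖ₑ ≤ ∫⁻ x, D.indicator (fun _ => 1) x * ENNReal.ofReal
      ((‖g x‖ + W x / F x * ‖z x‖ + √(W x) / F x * ‖w x‖) *
        (10 * F₀ * (‖u x‖ + (√p)⁻¹ * ‖φ x • v x‖))) := by
  refine (hz.enorm_inner_le hW hp.le hu hh ch rh haa hb).trans (lintegral_mono_ae ?_)
  filter_upwards [hg] with x hx
  by_cases hxs : x ∈ tsupport h
  swap
  · rw [indicator_of_notMem hxs, zero_mul]
    exact zero_le
  have hxD := hD hxs
  rw [indicator_of_mem hxs, indicator_of_mem hxD]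
  refine mul_le_mul_right (ENNReal.ofReal_le_ofReal ?_) _
  have f0 := hF₀ x hxD
  have fx := hF x
  have F0 : 0 < F₀ := by linarith
  have W0 := hW.nonneg x
  have c1 : ∀ r : ℝ, 0 ≤ r → r ≤ 2 * F₀ * (r / F x) := fun r hr => by
    rw [← mul_div_assoc, le_div_iff₀ fx, mul_comm]
    exact mul_le_mul_of_nonneg_right f0 hr
  -- Only p ≤ 4W is needed; W may exceed p by any amount because the weight W/F is controlled. This
  -- is why no constant depends on μ.
  have c2 : |W x - p| ≤ 5 * W x := by
    rw [abs_le]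
    constructor <;> linarith [hWp x hxD]
  have c3 : ‖a.symb h x‖ ≤ √(W x) := Real.le_sqrt_of_sq_le (hs x hxD)
  have sp : 0 < √p := Real.sqrt_pos.2 hp
  have t1 : ‖q x‖ * ‖u x‖ ≤ 2 * F₀ * (‖g x‖ * ‖u x‖) := by
    have : ‖q x‖ ≤ 2 * F₀ * ‖g x‖ :=
      hx.trans (mul_le_mul_of_nonneg_right f0 (norm_nonneg _))
    calc _ ≤ 2 * F₀ * ‖g x‖ * ‖u x‖ := mul_le_mul_of_nonneg_right this (norm_nonneg _)
      _ = _ := by ring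
  have t2 : |W x - p| * ‖z x‖ * ‖u x‖ ≤ 10 * F₀ * (W x / F x * ‖z x‖ * ‖u x‖) := by
    have : |W x - p| ≤ 10 * F₀ * (W x / F x) := by linarith [c1 _ W0]
    calc _ ≤ 10 * F₀ * (W x / F x) * ‖z x‖ * ‖u x‖ := by gcongr
      _ = _ := by ring
  have t3 : ‖a.symb h x‖ * ‖w x‖ * ‖u x‖ ≤ 2 * F₀ * (√(W x) / F x * ‖w x‖ * ‖u x‖) := by
    have : ‖a.symb h x‖ ≤ 2 * F₀ * (√(W x) / F x) := c3.trans (c1 _ (Real.sqrt_nonneg _))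
    calc _ ≤ 2 * F₀ * (√(W x) / F x) * ‖w x‖ * ‖u x‖ := by gcongr
      _ = _ := by ring
  -- Here the shell matters: the commutator vanishes unless φ = 1, so |v| may be replaced by |φv|.
  -- From |[A,h]| ≤ √W and √p ≤ 2√W one gets |[A,h]| ≤ 2W/√p, which supplies the factor p^(-1/2).
  have t4 : ‖a.symb h x‖ * ‖z x‖ * ‖v x‖ ≤
      4 * F₀ * (W x / F x * ‖z x‖ * ((√p)⁻¹ * ‖φ x • v x‖)) := by
    by_cases hd : fderiv ℝ h x = 0
    · rw [a.symb_eq_zero hd, norm_zero, zero_mul, zero_mul]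
      positivity
    · rw [hφ x hd, one_smul]
      have d1 : √p ≤ 2 * √(W x) := by
        rw [Real.sqrt_le_left (by positivity), mul_pow, Real.sq_sqrt W0]
        linarith [hWp x hxD]
      have d2 : ‖a.symb h x‖ ≤ 2 * W x * (√p)⁻¹ := by
        rw [← div_eq_mul_inv, le_div_iff₀ sp]
        calc ‖a.symb h x‖ * √p ≤ √(W x) * (2 * √(W x)) :=
              mul_le_mul c3 d1 sp.le (Real.sqrt_nonneg _)
          _ = 2 * (√(W x) * √(W x)) := by ring
          _ = 2 * W x := by rw [Real.mul_self_sqrt W0]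
      have d3 : ‖a.symb h x‖ ≤ 4 * F₀ * (W x / F x) * (√p)⁻¹ := by
        refine d2.trans (mul_le_mul_of_nonneg_right ?_ (inv_nonneg.2 sp.le))
        linarith [c1 _ W0]
      calc _ ≤ 4 * F₀ * (W x / F x) * (√p)⁻¹ * ‖z x‖ * ‖v x‖ := by gcongr
        _ = _ := by ring
  set A := W x / F x * ‖z x‖
  set B := √(W x) / F x * ‖w x‖
  set Y := (√p)⁻¹ * ‖φ x • v x‖
  have A0 : 0 ≤ A := by positivity
  have B0 : 0 ≤ B := by positivity
  have Y0 : 0 ≤ Y := by positivity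
  have U0 := norm_nonneg (u x)
  have G0 := norm_nonneg (g x)
  -- This is what remains of the product 10F₀(|g|+A+B)(|u|+Y) after subtracting the bounds
  -- `t1`–`t4`, whose coefficients are 2, 10, 2 and 4.
  have : 0 ≤ F₀ * (8 * (‖g x‖ * ‖u x‖) + 8 * (B * ‖u x‖) + 6 * (A * Y) + 10 * (‖g x‖ * Y) +
    10 * (B * Y)) := by positivity
  linarith


/-! ### The duality argument -/

theorem ofReal_norm_sq_eq_lintegral (g : L2 k) :
    ENNReal.ofReal (‖g‖ ^ 2) = ∫⁻ x, ENNReal.ofReal (‖g x‖ ^ 2) := by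
  rw [← ofReal_integral_eq_lintegral_ofReal ((Lp.memLp g).integrable_norm_pow (p := 2)
    (by norm_num)) (ae_of_all _ fun _ => sq_nonneg _)]
  congr 1
  have h : ⟪g, g⟫_ℂ = ∫ x, ((‖g x‖ ^ 2 : ℝ) : ℂ) := by
    rw [L2.inner_def]
    refine integral_congr_ae (ae_of_all _ fun x => ?_)
    simp only [inner_self_eq_norm_sq_to_K]
    push_cast
    rfl
  rw [inner_self_eq_norm_sq_to_K, integral_complex_ofReal] at h
  exact Complex.ofReal_injective ((Complex.ofReal_pow _ _).trans h)

/-- Decomposition of the source along a partition of unity. -/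
theorem IsLocalization.enorm_inner_le_tsum {ι : Type} [Countable ι] {N : ℕ} {B : ι → Set R3}
    {θ : ι → R3 → ℝ} (hθ : IsLocalization N B θ) (z f : L2 k) {b : ι → L2 k}
    (hb : ∀ i, b i =ᵐ[volume] fun x => θ i x ^ 2 • f x) :
    ‖⟪z, f⟫_ℂ‖ₑ ≤ ∑' i, ‖⟪z, b i⟫_ℂ‖ₑ := by
  have i0 : Integrable (fun x => ⟪z x, f x⟫_ℂ) (volume : Measure R3) := L2.integrable_inner z f
  have e1 : ∀ x, ∑' i, ((θ i x ^ 2 : ℝ) : ℂ) * ⟪z x, f x⟫_ℂ = ⟪z x, f x⟫_ℂ := fun x => by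
    rw [tsum_mul_right, ← Complex.ofReal_tsum, (hθ.hasSum x).tsum_eq, Complex.ofReal_one, one_mul]
  have e2 : ∀ i, ∫ x, ((θ i x ^ 2 : ℝ) : ℂ) * ⟪z x, f x⟫_ℂ = ⟪z, b i⟫_ℂ := fun i => by
    rw [L2.inner_def]
    refine integral_congr_ae ?_
    filter_upwards [hb i] with x hx
    rw [hx, ← Complex.coe_smul (θ i x ^ 2) (f x), inner_smul_right]
  have m : ∀ i, AEStronglyMeasurable (fun x => ((θ i x ^ 2 : ℝ) : ℂ) * ⟪z x, f x⟫_ℂ)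
      (volume : Measure R3) := fun i => by
    have := (hθ.smooth i).continuous
    exact (Continuous.aestronglyMeasurable (by fun_prop)).mul i0.aestronglyMeasurable
  -- Since ∑θᵢ² = 1, the summed absolute values are dominated by the integrable function |⟪z, f⟫|,
  -- so sum and integral can be interchanged.
  have hfin : ∑' i, ∫⁻ x, ‖((θ i x ^ 2 : ℝ) : ℂ) * ⟪z x, f x⟫_ℂ‖ₑ ≠ ⊤ := by
    rw [← lintegral_tsum fun i => (m i).enorm]
    refine ne_top_of_le_ne_top i0.2.ne (lintegral_mono fun x => ?_)
    rw [← ofReal_norm (⟪z x, f x⟫_ℂ), ← hθ.tsum_mul x (norm_nonneg (⟪z x, f x⟫_ℂ))]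
    refine ENNReal.tsum_le_tsum fun i => ?_
    rw [← ofReal_norm, norm_mul, Complex.norm_real, Real.norm_of_nonneg (sq_nonneg _)]
  have key := integral_tsum m hfin
  simp only [e1, e2] at key
  rw [L2.inner_def, key]
  exact enorm_tsum_le_tsum_enorm

/-- Weak solutions pair symmetrically. -/
theorem IsWeakSol.inner_symm {a : FirstOrder k} {W : R3 → ℝ} {u w f z v q : L2 k}
    (h : IsWeakSol a W u w f) (h' : IsWeakSol a W z v q) : ⟪z, f⟫_ℂ = ⟪q, u⟫_ℂ := by
  obtain ⟨u1, m, u2, u3⟩ := h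
  obtain ⟨z1, n, z2, z3⟩ := h'
  rw [← u3 _ _ _ z1 z2, ← inner_conj_symm q u, ← z3 _ _ _ u1 u2, map_add, inner_conj_symm,
    inner_conj_symm]

/-- A priori bound in terms of a source supported where `W` is bounded below. -/
theorem IsWeakSol.norm_sq_le {a : FirstOrder k} {W : R3 → ℝ} (hW : ∀ x, 0 ≤ W x) {δ : ℝ}
    (hδ : 0 ≤ δ) {z w q : L2 k} (h : IsWeakSol a (fun x => W x + δ) z w q) {n : ℝ}
    (hn : 0 ≤ n) (hq : ∀ᵐ x ∂(volume : Measure R3), q x ≠ 0 → 1 ≤ n * W x) :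
    δ * ‖z‖ ^ 2 ≤ n * ‖q‖ ^ 2 := by
  obtain ⟨z1, m, z2, z3⟩ := h
  have k1 := z3 _ _ _ z1 z2
  have r : ∀ s t : L2 k, (⟪s, t⟫_ℂ).re = ∫ x, (⟪s x, t x⟫_ℂ).re := fun s t => by
    rw [L2.inner_def]
    exact (integral_re (L2.integrable_inner (𝕜 := ℂ) s t)).symm
  have ir : ∀ s t : L2 k, Integrable (fun x => (⟪s x, t x⟫_ℂ).re) (volume : Measure R3) :=
    fun s t => (L2.integrable_inner (𝕜 := ℂ) s t).re
  have sq : ∀ s : L2 k, (⟪s, s⟫_ℂ).re = ‖s‖ ^ 2 := fun s => inner_self_eq_norm_sq (𝕜 := ℂ) s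
  have sq' : ∀ s : Cn k, (⟪s, s⟫_ℂ).re = ‖s‖ ^ 2 := fun s => inner_self_eq_norm_sq (𝕜 := ℂ) s
  have k2 : ‖w‖ ^ 2 + (⟪m, m⟫_ℂ).re = (⟪z, q⟫_ℂ).re := by
    rw [← sq w, ← Complex.add_re, k1]
  have k3 : δ * (⟪z, z⟫_ℂ).re + (⟪z, q⟫_ℂ).re ≤ (⟪m, m⟫_ℂ).re + n * (⟪q, q⟫_ℂ).re := by
    rw [r, r, r, r, ← integral_const_mul, ← integral_const_mul,
      ← integral_add ((ir _ _).const_mul _) (ir _ _), ← integral_add (ir _ _)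
      ((ir _ _).const_mul _)]
    refine integral_mono_ae (((ir _ _).const_mul _).add (ir _ _)) ((ir _ _).add
      ((ir _ _).const_mul _)) ?_
    filter_upwards [mem_mulGraph.1 z2, hq] with x e1 e2
    simp only [sq', e1]
    rw [norm_smul, mul_pow, Real.norm_of_nonneg (Real.sqrt_nonneg _),
      Real.sq_sqrt (add_nonneg (hW x) hδ)]
    have e3 : (⟪z x, q x⟫_ℂ).re ≤ ‖z x‖ * ‖q x‖ :=
      (Complex.re_le_norm _).trans (norm_inner_le_norm _ _)
    -- On the support of `q`, 1 ≤ √(nW), so the source is absorbed by W|z|² and the whole δ‖z‖²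
    -- remains. The result is that √δ‖z‖ stays bounded as δ → 0.
    have e4 : ‖z x‖ * ‖q x‖ ≤ W x * ‖z x‖ ^ 2 + n * ‖q x‖ ^ 2 := by
      by_cases h0 : q x = 0
      · rw [h0]
        have := hW x
        simp only [norm_zero, mul_zero]
        positivity
      · have e5 := e2 h0
        have e6 := hW x
        have e7 : ‖z x‖ * ‖q x‖ ≤ (√(W x) * ‖z x‖) * (√n * ‖q x‖) := by
          calc ‖z x‖ * ‖q x‖ = 1 * (‖z x‖ * ‖q x‖) := (one_mul _).symm
            _ ≤ √(n * W x) * (‖z x‖ * ‖q x‖) := by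
                refine mul_le_mul_of_nonneg_right ?_ (by positivity)
                rw [Real.one_le_sqrt]
                exact e5
            _ = _ := by
                rw [Real.sqrt_mul hn]
                ring
        have e8 : (√(W x) * ‖z x‖) ^ 2 = W x * ‖z x‖ ^ 2 := by rw [mul_pow, Real.sq_sqrt e6]
        have e9 : (√n * ‖q x‖) ^ 2 = n * ‖q x‖ ^ 2 := by rw [mul_pow, Real.sq_sqrt hn]
        nlinarith [sq_nonneg (√(W x) * ‖z x‖ - √n * ‖q x‖), sq_nonneg (√(W x) * ‖z x‖),
          sq_nonneg (√n * ‖q x‖)]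
    nlinarith
  rw [sq z, sq q] at k3
  nlinarith [sq_nonneg ‖w‖]

/-- The quantity controlling the contribution of a local problem. -/
noncomputable def localTerm (F₀ p : ℝ) (φ : R3 → ℝ) (u v : L2 k) : ℝ≥0∞ :=
  ∫⁻ x, ENNReal.ofReal (F₀ ^ 2 * (‖u x‖ + (√p)⁻¹ * ‖φ x • v x‖) ^ 2)

/-- The data of the localization: `D i` are the localization regions around `x i`, on which `P` and
`F` vary slowly, `θ` is the partition of unity and `h` are the cutoff functions. -/
structure LocalData (a : FirstOrder k) (P F : R3 → ℝ) {ι : Type} (N : ℕ) (D : ι → Set R3)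
    (x : ι → R3) (θ h φ : ι → R3 → ℝ) (aloc : ι → FirstOrder k) (κ : ℝ) : Prop where
  potential : IsPotential P
  pos : ∀ y, 0 < P y
  measurable_F : Measurable F
  pos_F : ∀ y, 0 < F y
  loc : IsLocalization N D θ
  κ_nonneg : 0 ≤ κ
  κ_small : 512 * κ * (N + 1) ≤ 1 / 4
  symb_θ : ∀ i, ∀ y ∈ D i, ‖a.symb (θ i) y‖ ^ 2 ≤ κ * P y
  P_le : ∀ i, ∀ y ∈ D i, P y ≤ 4 * P (x i)
  le_P : ∀ i, ∀ y ∈ D i, P (x i) ≤ 4 * P y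
  F_le : ∀ i, ∀ y ∈ D i, F y ≤ 2 * F (x i)
  le_F : ∀ i, ∀ y ∈ D i, F (x i) ≤ 2 * F y
  smooth_h : ∀ i, ContDiff ℝ ∞ (h i)
  compact_h : ∀ i, HasCompactSupport (h i)
  range_h : ∀ i y, h i y ∈ Icc (0 : ℝ) 1
  supp_h : ∀ i, tsupport (h i) ⊆ D i
  h_eq_one : ∀ i y, θ i y ≠ 0 → h i y = 1
  symb_h : ∀ i, ∀ y ∈ D i, ‖a.symb (h i) y‖ ^ 2 ≤ P y
  φ_eq_one : ∀ i y, fderiv ℝ (h i) y ≠ 0 → φ i y = 1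
  continuous_φ : ∀ i, Continuous (φ i)
  coeff : ∀ i, ∀ y ∈ tsupport (h i), (aloc i).princ y = a.princ y ∧ (aloc i).pot y = a.pot y

theorem young_pointwise {X Y F₀ l : ℝ} (hl : 0 < l) :
    X * (10 * F₀ * Y) ≤ l / 2 * X ^ 2 + 50 / l * (F₀ ^ 2 * Y ^ 2) := by
  have : 0 ≤ (l * X - 10 * F₀ * Y) ^ 2 / (2 * l) := by positivity
  have e : (l * X - 10 * F₀ * Y) ^ 2 / (2 * l) =
      l / 2 * X ^ 2 + 50 / l * (F₀ ^ 2 * Y ^ 2) - X * (10 * F₀ * Y) := by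
    field_simp
    ring
  linarith

/-- The pairing of a solution of the dual problem with the source. -/
theorem LocalData.enorm_inner_le {a : FirstOrder k} {P F : R3 → ℝ} {ι : Type} [Countable ι] {N : ℕ}
    {D : ι → Set R3} {x : ι → R3} {θ h φ : ι → R3 → ℝ} {aloc : ι → FirstOrder k} {κ : ℝ}
    (H : LocalData a P F N D x θ h φ aloc κ) {μ : ℝ} (hμ : 0 ≤ μ) {z w q g f : L2 k}
    (hz : IsWeakSol a (fun y => P y + μ) z w q)
    (hg : ∀ᵐ y ∂(volume : Measure R3), ‖q y‖ ≤ F y * ‖g y‖) {u v b : ι → L2 k}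
    (hu : ∀ i, IsWeakSol (aloc i) (fun _ => P (x i)) (u i) (v i) (b i))
    (hb : ∀ i, b i =ᵐ[volume] fun y => θ i y ^ 2 • f y) :
    ‖⟪z, f⟫_ℂ‖ₑ ≤ ENNReal.ofReal (1 / 2 * ‖g‖ ^ 2) + ENNReal.ofReal (20000000 * (N + 1)) *
      ∑' i, localTerm (F (x i)) (P (x i)) (φ i) (u i) (v i) := by
  set W : R3 → ℝ := fun y => P y + μ with hWdef
  have hW : IsPotential W := H.potential.add_const hμ
  have W0 : ∀ y, 0 < W y := fun y => add_pos_of_pos_of_nonneg (H.pos y) hμ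
  have PW : ∀ y, P y ≤ W y := fun y => le_add_of_nonneg_right hμ
  -- The Young parameter is chosen so that (N+1)·(l/2)·400000 = ½; the other side then gets 50/l =
  -- 20000000(N+1).
  set l : ℝ := 1 / (400000 * (N + 1)) with hl
  have l0 : 0 < l := by positivity
  have mF := H.measurable_F
  have mW := hW.measurable
  have mz : AEMeasurable (fun x => ‖z x‖) (volume : Measure R3) :=
    (Lp.aestronglyMeasurable z).norm.aemeasurable
  have mw : AEMeasurable (fun x => ‖w x‖) (volume : Measure R3) :=
    (Lp.aestronglyMeasurable w).norm.aemeasurable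
  have mg : AEMeasurable (fun x => ‖g x‖) (volume : Measure R3) :=
    (Lp.aestronglyMeasurable g).norm.aemeasurable
  let X : R3 → ℝ := fun y => ‖g y‖ + W y / F y * ‖z y‖ + √(W y) / F y * ‖w y‖
  have mX : AEMeasurable X (volume : Measure R3) := by fun_prop
  -- The factor 400000 dominates 3(1 + 131072), the 3 coming from squaring a sum of three terms.
  have hX : ∫⁻ y, ENNReal.ofReal (X y ^ 2) ≤ ENNReal.ofReal (400000 * ‖g‖ ^ 2) := by
    have k1 := hz.weighted_energy_final mW W0 mF H.pos_F H.loc H.κ_nonneg H.κ_small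
      (fun i y hy => (H.symb_θ i y hy).trans (mul_le_mul_of_nonneg_left (PW y) H.κ_nonneg))
      (x := x) (fun i y hy => by simp only [hWdef]; linarith [H.P_le i y hy])
      (fun i y hy => by simp only [hWdef]; linarith [H.le_P i y hy]) H.F_le H.le_F hg
    have k2 : ∀ (c : ℝ), 0 ≤ c → ∀ s : R3 → ℝ, ∫⁻ y, ENNReal.ofReal (c * s y) =
        ENNReal.ofReal c * ∫⁻ y, ENNReal.ofReal (s y) := fun c hc s => by
      rw [← lintegral_const_mul' _ _ ENNReal.ofReal_ne_top]
      exact lintegral_congr fun y => ENNReal.ofReal_mul hc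
    calc ∫⁻ y, ENNReal.ofReal (X y ^ 2) ≤ ∫⁻ y, (ENNReal.ofReal (3 * ‖g y‖ ^ 2) +
          ENNReal.ofReal (3 * (W y / F y ^ 2 * (‖w y‖ ^ 2 + W y * ‖z y‖ ^ 2)))) := by
          refine lintegral_mono fun y => ?_
          have := W0 y
          simp only
          rw [← ENNReal.ofReal_add (by positivity) (by positivity)]
          refine ENNReal.ofReal_le_ofReal ?_
          have e1 : (W y / F y * ‖z y‖) ^ 2 = W y / F y ^ 2 * (W y * ‖z y‖ ^ 2) := by
            rw [mul_pow, div_pow]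
            ring
          have e2 : (√(W y) / F y * ‖w y‖) ^ 2 = W y / F y ^ 2 * ‖w y‖ ^ 2 := by
            rw [mul_pow, div_pow, Real.sq_sqrt this.le]
          simp only [X]
          set α := W y / F y * ‖z y‖
          set β := √(W y) / F y * ‖w y‖
          rw [mul_add, ← e1, ← e2]
          nlinarith [sq_nonneg (‖g y‖ - α), sq_nonneg (‖g y‖ - β), sq_nonneg (α - β)]
      _ = (∫⁻ y, ENNReal.ofReal (3 * ‖g y‖ ^ 2)) +
          ∫⁻ y, ENNReal.ofReal (3 * (W y / F y ^ 2 * (‖w y‖ ^ 2 + W y * ‖z y‖ ^ 2))) :=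
          lintegral_add_left' (by fun_prop) _
      _ ≤ ENNReal.ofReal 3 * ENNReal.ofReal (‖g‖ ^ 2) +
          ENNReal.ofReal 3 * (ENNReal.ofReal 131072 * ENNReal.ofReal (‖g‖ ^ 2)) := by
          rw [k2 3 (by norm_num), k2 3 (by norm_num), ofReal_norm_sq_eq_lintegral,
            ← k2 131072 (by norm_num)]
          exact add_le_add le_rfl (mul_le_mul_right k1 _)
      _ ≤ _ := by
          rw [← ENNReal.ofReal_mul (by norm_num), ← ENNReal.ofReal_mul (by norm_num),
            ← ENNReal.ofReal_mul (by norm_num), ← ENNReal.ofReal_add (by positivity)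
            (by positivity)]
          refine ENNReal.ofReal_le_ofReal ?_
          nlinarith [sq_nonneg ‖g‖]
  have term : ∀ i, ‖⟪z, b i⟫_ℂ‖ₑ ≤
      (∫⁻ y, (D i).indicator (fun _ => (1 : ℝ≥0∞)) y * ENNReal.ofReal (l / 2 * X y ^ 2)) +
      ENNReal.ofReal (50 / l) * localTerm (F (x i)) (P (x i)) (φ i) (u i) (v i) := by
    intro i
    refine (hz.enorm_inner_le_weighted hW H.pos_F (H.pos (x i)) (hu i) (H.smooth_h i)
      (H.compact_h i) (H.range_h i) (H.coeff i) ?_ hg (H.supp_h i) (H.F_le i)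
      (fun y hy => (H.le_P i y hy).trans (by linarith [PW y]))
      (fun y hy => (H.symb_h i y hy).trans (PW y)) (H.φ_eq_one i)).trans ?_
    · filter_upwards [hb i] with y hy hne
      rw [hy, not_not.1 (mt (H.h_eq_one i y) hne)]
      simp
    · have m1 : Measurable ((D i).indicator (fun _ => (1 : ℝ≥0∞))) :=
        measurable_const.indicator (H.loc.measurableSet i)
      rw [localTerm, ← lintegral_const_mul' _ _ ENNReal.ofReal_ne_top,
        ← lintegral_add_left' (by fun_prop)]
      refine lintegral_mono fun y => ?_
      by_cases hy : y ∈ D i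
      · simp only [indicator_of_mem hy, one_mul]
        rw [← ENNReal.ofReal_mul (by positivity), ← ENNReal.ofReal_add (by positivity)
          (by positivity)]
        exact ENNReal.ofReal_le_ofReal (young_pointwise l0)
      · simp [indicator_of_notMem hy]
  calc ‖⟪z, f⟫_ℂ‖ₑ ≤ ∑' i, ‖⟪z, b i⟫_ℂ‖ₑ := H.loc.enorm_inner_le_tsum z f hb
    _ ≤ ∑' i, ((∫⁻ y, (D i).indicator (fun _ => (1 : ℝ≥0∞)) y *
        ENNReal.ofReal (l / 2 * X y ^ 2)) +
        ENNReal.ofReal (50 / l) * localTerm (F (x i)) (P (x i)) (φ i) (u i) (v i)) :=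
        ENNReal.tsum_le_tsum term
    _ = (∫⁻ y, ∑' i, (D i).indicator (fun _ => (1 : ℝ≥0∞)) y *
        ENNReal.ofReal (l / 2 * X y ^ 2)) +
        ENNReal.ofReal (50 / l) * ∑' i, localTerm (F (x i)) (P (x i)) (φ i) (u i) (v i) := by
        rw [ENNReal.tsum_add, ENNReal.tsum_mul_left, lintegral_tsum fun i => ?_]
        have m1 : Measurable ((D i).indicator (fun _ => (1 : ℝ≥0∞))) :=
          measurable_const.indicator (H.loc.measurableSet i)
        fun_prop
    _ ≤ ENNReal.ofReal ((N + 1) * (l / 2)) * ENNReal.ofReal (400000 * ‖g‖ ^ 2) +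
        ENNReal.ofReal (50 / l) * ∑' i, localTerm (F (x i)) (P (x i)) (φ i) (u i) (v i) := by
        refine add_le_add ((lintegral_mono fun y => ?_).trans
          ((lintegral_const_mul' (ENNReal.ofReal ((N + 1) * (l / 2)))
            (fun y => ENNReal.ofReal (X y ^ 2)) ENNReal.ofReal_ne_top).trans_le
              (mul_le_mul_right hX _))) le_rfl
        simp only
        rw [ENNReal.tsum_mul_right, ENNReal.ofReal_mul (by positivity : (0 : ℝ) ≤ N + 1),
          mul_assoc, ← ENNReal.ofReal_mul (by positivity : 0 ≤ l / 2),
          ENNReal.ofReal_add (by positivity) zero_le_one]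
        refine mul_le_mul_left ((H.loc.overlap y).trans_eq ?_) _
        simp
    _ = _ := by
        rw [← ENNReal.ofReal_mul (by positivity)]
        congr 2
        · rw [hl]
          field_simp
        · rw [hl]
          congr 1
          field_simp
          norm_num


/-- The pull-in estimate on the set where `F` is bounded and `P` is bounded below. -/
theorem LocalData.truncated_estimate {a : FirstOrder k} {P F : R3 → ℝ} {ι : Type} [Countable ι]
    {N : ℕ} {D : ι → Set R3} {x : ι → R3} {θ h φ : ι → R3 → ℝ} {aloc : ι → FirstOrder k} {κ : ℝ}
    (H : LocalData a P F N D x θ h φ aloc κ) {μ : ℝ} (hμ : 0 ≤ μ) {u₀ w₀ f : L2 k}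
    (h₀ : IsWeakSol a (fun y => P y + μ) u₀ w₀ f) {u v b : ι → L2 k}
    (hu : ∀ i, IsWeakSol (aloc i) (fun _ => P (x i)) (u i) (v i) (b i))
    (hb : ∀ i, b i =ᵐ[volume] fun y => θ i y ^ 2 • f y) {n : ℝ} (hn : 0 ≤ n) :
    ∫⁻ y, ENNReal.ofReal
      ({y | F y ≤ n ∧ 1 ≤ n * P y}.indicator (fun y => F y ^ 2 * ‖u₀ y‖ ^ 2) y) ≤
      ENNReal.ofReal (40000000 * (N + 1)) *
        ∑' i, localTerm (F (x i)) (P (x i)) (φ i) (u i) (v i) := by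
  -- On `E` the weight F is bounded, so g = F u₀ and q = F²u₀ are in `L²`; and P ≥ 1/n there, so the
  -- regularized dual solution is controlled. Outside `E` both are set to zero.
  set E : Set R3 := {y | F y ≤ n ∧ 1 ≤ n * P y} with hE
  have mE : MeasurableSet E := (measurableSet_le H.measurable_F measurable_const).inter
    (measurableSet_le measurable_const (H.potential.measurable.const_mul n))
  have mem : ∀ (s : R3 → ℝ) (C : ℝ), Measurable s → (∀ y ∈ E, |s y| ≤ C) → 0 ≤ C →
      MemLp (fun y => E.indicator s y • u₀ y) 2 (volume : Measure R3) := by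
    intro s C ms hs hC
    refine (Lp.memLp u₀).of_le_mul (c := C)
      ((ms.indicator mE).aestronglyMeasurable.smul (Lp.aestronglyMeasurable u₀))
      (ae_of_all _ fun y => ?_)
    rw [norm_smul]
    refine mul_le_mul_of_nonneg_right ?_ (norm_nonneg _)
    by_cases hy : y ∈ E
    · rw [indicator_of_mem hy]
      exact hs y hy
    · rw [indicator_of_notMem hy, norm_zero]
      exact hC
  have hg := mem F n H.measurable_F (fun y hy => by
    rw [abs_of_pos (H.pos_F y)]
    exact hy.1) hn
  have hq := mem (fun y => F y ^ 2) (n ^ 2) (H.measurable_F.pow_const 2) (fun y hy => by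
    rw [abs_of_nonneg (sq_nonneg _)]
    exact pow_le_pow_left₀ (H.pos_F y).le hy.1 2) (sq_nonneg n)
  set g : L2 k := hg.toLp _ with hgdef
  set q : L2 k := hq.toLp _ with hqdef
  have eg : g =ᵐ[volume] fun y => E.indicator F y • u₀ y := hg.coeFn_toLp
  have eq : q =ᵐ[volume] fun y => E.indicator (fun y => F y ^ 2) y • u₀ y := hq.coeFn_toLp
  have hLHS : ∫⁻ y, ENNReal.ofReal (E.indicator (fun y => F y ^ 2 * ‖u₀ y‖ ^ 2) y) =
      ENNReal.ofReal (‖g‖ ^ 2) := by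
    rw [ofReal_norm_sq_eq_lintegral]
    refine lintegral_congr_ae ?_
    filter_upwards [eg] with y hy
    rw [hy, norm_smul, mul_pow]
    by_cases h : y ∈ E <;> simp [h]
  have hqu : ⟪q, u₀⟫_ℂ = ((‖g‖ ^ 2 : ℝ) : ℂ) := by
    have : ⟪q, u₀⟫_ℂ = ⟪g, g⟫_ℂ := by
      rw [L2.inner_def, L2.inner_def]
      refine integral_congr_ae ?_
      filter_upwards [eg, eq] with y h1 h2
      rw [h1, h2]
      by_cases h : y ∈ E
      · rw [indicator_of_mem h, indicator_of_mem h, ← Complex.coe_smul, ← Complex.coe_smul,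
          inner_smul_left, inner_smul_left, inner_smul_right]
        simp only [Complex.conj_ofReal]
        push_cast
        ring
      · simp [h]
    rw [this, inner_self_eq_norm_sq_to_K]
    push_cast
    rfl
  have hqg : ∀ᵐ y ∂(volume : Measure R3), ‖q y‖ ≤ F y * ‖g y‖ := by
    filter_upwards [eg, eq] with y h1 h2
    rw [h1, h2]
    by_cases h : y ∈ E
    · rw [indicator_of_mem h, indicator_of_mem h, norm_smul, norm_smul,
        Real.norm_of_nonneg (sq_nonneg _), Real.norm_of_nonneg (H.pos_F y).le]
      exact le_of_eq (by ring)
    · simp [h]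
  have hqP : ∀ᵐ y ∂(volume : Measure R3), q y ≠ 0 → 1 ≤ n * (P y + μ) := by
    filter_upwards [eq] with y h2 h0
    have hy : y ∈ E := by
      by_contra h
      rw [h2, indicator_of_notMem h, zero_smul] at h0
      exact h0 rfl
    exact hy.2.trans (mul_le_mul_of_nonneg_left (by linarith) hn)
  rw [hLHS]
  set R := ∑' i, localTerm (F (x i)) (P (x i)) (φ i) (u i) (v i)
  rcases eq_or_ne R ⊤ with hR | hR
  · rw [hR, ENNReal.mul_top]
    · exact le_top
    · rw [ne_eq, ENNReal.ofReal_eq_zero, not_le]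
      positivity
  have hWp := H.potential.add_const hμ
  -- When P + μ has no positive lower bound the dual equation may be unsolvable, so δ is added. The
  -- error δ⟪z, u₀⟫ is O(√δ) because √δ‖z‖ is bounded.
  have key : ∀ δ : ℝ, 0 < δ → ‖g‖ ^ 2 ≤ 1 / 2 * ‖g‖ ^ 2 + 20000000 * (N + 1) * R.toReal +
      √δ * (√n * ‖q‖ * ‖u₀‖) := by
    intro δ hδ
    obtain ⟨z, w, hz⟩ := exists_isWeakSol_add_const a hWp.measurable hWp.nonneg hδ q
    have e1 := ((isWeakSol_add_const hWp.measurable hWp.nonneg hδ.le).1 hz)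
    have e2 := h₀.inner_symm e1
    rw [inner_sub_left, inner_smul_left, Complex.conj_ofReal, hqu] at e2
    have e3 := hz.norm_sq_le hWp.nonneg hδ.le hn hqP
    have e4 : √δ * ‖z‖ ≤ √n * ‖q‖ := by
      refine le_of_sq_le_sq ?_ (by positivity)
      rw [mul_pow, mul_pow, Real.sq_sqrt hδ.le, Real.sq_sqrt hn]
      exact e3
    -- The shift δ is absorbed into μ, on which the pairing bound does not depend.
    have hz' : IsWeakSol a (fun y => P y + (μ + δ)) z w q := by
      simpa only [add_assoc] using hz
    have e5 := H.enorm_inner_le (add_nonneg hμ hδ.le) hz' hqg hu hb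
    have e6 : ‖⟪z, f⟫_ℂ‖ ≤ 1 / 2 * ‖g‖ ^ 2 + 20000000 * (N + 1) * R.toReal := by
      have h1 : ENNReal.ofReal (1 / 2 * ‖g‖ ^ 2) + ENNReal.ofReal (20000000 * (N + 1)) * R =
          ENNReal.ofReal (1 / 2 * ‖g‖ ^ 2 + 20000000 * (N + 1) * R.toReal) := by
        rw [ENNReal.ofReal_add (by positivity) (by positivity),
          ENNReal.ofReal_mul (by positivity : (0 : ℝ) ≤ 20000000 * (N + 1)),
          ENNReal.ofReal_toReal hR]
      rw [h1, ← ofReal_norm] at e5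
      exact (ENNReal.ofReal_le_ofReal_iff (by positivity)).1 e5
    have e7 : ‖g‖ ^ 2 ≤ ‖⟪z, f⟫_ℂ‖ + δ * (‖z‖ * ‖u₀‖) := by
      have h1 : ((‖g‖ ^ 2 : ℝ) : ℂ) = ⟪z, f⟫_ℂ + δ * ⟪z, u₀⟫_ℂ := by rw [e2]; ring
      calc ‖g‖ ^ 2 = ‖((‖g‖ ^ 2 : ℝ) : ℂ)‖ := by
            rw [Complex.norm_real, Real.norm_of_nonneg (sq_nonneg _)]
        _ ≤ ‖⟪z, f⟫_ℂ‖ + ‖(δ : ℂ) * ⟪z, u₀⟫_ℂ‖ := by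
            rw [h1]
            exact norm_add_le _ _
        _ ≤ _ := by
            rw [norm_mul, Complex.norm_real, Real.norm_of_nonneg hδ.le]
            gcongr
            exact norm_inner_le_norm _ _
    have e8 : δ * (‖z‖ * ‖u₀‖) ≤ √δ * (√n * ‖q‖ * ‖u₀‖) := by
      calc δ * (‖z‖ * ‖u₀‖) = √δ * ((√δ * ‖z‖) * ‖u₀‖) := by
            nth_rewrite 1 [← Real.mul_self_sqrt hδ.le]
            ring
        _ ≤ _ := by gcongr
    linarith
  have lim : ‖g‖ ^ 2 ≤ 1 / 2 * ‖g‖ ^ 2 + 20000000 * (N + 1) * R.toReal := by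
    refine le_of_forall_pos_le_add fun η hη => ?_
    set K := √n * ‖q‖ * ‖u₀‖
    have K0 : 0 ≤ K := by positivity
    have h1 := key ((η / (K + 1)) ^ 2) (by positivity)
    rw [Real.sqrt_sq (by positivity)] at h1
    have h2 : η / (K + 1) * K ≤ η := by
      rw [div_mul_eq_mul_div, div_le_iff₀ (by positivity)]
      nlinarith
    linarith
  rw [← ENNReal.ofReal_toReal hR, ← ENNReal.ofReal_mul (by positivity)]
  refine ENNReal.ofReal_le_ofReal ?_
  linarith

/-- The pull-in estimate. -/
theorem LocalData.estimate {a : FirstOrder k} {P F : R3 → ℝ} {ι : Type} [Countable ι]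
    {N : ℕ} {D : ι → Set R3} {x : ι → R3} {θ h φ : ι → R3 → ℝ} {aloc : ι → FirstOrder k} {κ : ℝ}
    (H : LocalData a P F N D x θ h φ aloc κ) {μ : ℝ} (hμ : 0 ≤ μ) {u₀ w₀ f : L2 k}
    (h₀ : IsWeakSol a (fun y => P y + μ) u₀ w₀ f) {u v b : ι → L2 k}
    (hu : ∀ i, IsWeakSol (aloc i) (fun _ => P (x i)) (u i) (v i) (b i))
    (hb : ∀ i, b i =ᵐ[volume] fun y => θ i y ^ 2 • f y) :
    ∫⁻ y, ENNReal.ofReal (F y ^ 2 * ‖u₀ y‖ ^ 2) ≤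
      ENNReal.ofReal (40000000 * (N + 1)) *
        ∑' i, localTerm (F (x i)) (P (x i)) (φ i) (u i) (v i) := by
  have mu : AEMeasurable (fun x => ‖u₀ x‖) (volume : Measure R3) :=
    (Lp.aestronglyMeasurable u₀).norm.aemeasurable
  have mF := H.measurable_F
  -- The sets {F ≤ n, P ≥ 1/n} increase to the whole space, as F is finite and P is positive.
  refine le_of_tendsto' (lintegral_tendsto_of_tendsto_of_monotone (f := fun (n : ℕ) y =>
    ENNReal.ofReal ({y | F y ≤ n ∧ 1 ≤ n * P y}.indicator (fun y => F y ^ 2 * ‖u₀ y‖ ^ 2) y))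
    (fun n => ?_) (ae_of_all _ fun y n n' hn => ?_) (ae_of_all _ fun y => ?_))
    (fun n => H.truncated_estimate hμ h₀ hu hb n.cast_nonneg)
  · have mE : MeasurableSet {y | F y ≤ n ∧ 1 ≤ n * P y} :=
      (measurableSet_le H.measurable_F measurable_const).inter
        (measurableSet_le measurable_const (H.potential.measurable.const_mul _))
    exact ((by fun_prop : AEMeasurable (fun y => F y ^ 2 * ‖u₀ y‖ ^ 2) volume).indicator
      mE).ennreal_ofReal
  · refine ENNReal.ofReal_le_ofReal (indicator_le_indicator_of_subset (fun y hy => ?_)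
      (fun y => by positivity) y)
    have hnn : (n : ℝ) ≤ n' := by exact_mod_cast hn
    exact ⟨hy.1.trans hnn, hy.2.trans (mul_le_mul_of_nonneg_right hnn (H.pos y).le)⟩
  · refine tendsto_const_nhds.congr' ?_
    obtain ⟨n₀, hn₀⟩ := exists_nat_ge (max (F y) (1 / P y))
    filter_upwards [Filter.eventually_ge_atTop n₀] with n hn
    have h1 : max (F y) (1 / P y) ≤ n := hn₀.trans (by exact_mod_cast hn)
    rw [indicator_of_mem]
    exact ⟨(le_max_left _ _).trans h1, (div_le_iff₀ (H.pos y)).1 ((le_max_right _ _).trans h1)⟩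

/-- The local term is bounded by the corresponding term of the pull-in formula. -/
theorem localTerm_le {F₀ p : ℝ} (hF : 0 ≤ F₀) (hp : 0 < p) {φ : R3 → ℝ} (hφ : Continuous φ)
    (u v : L2 k) :
    localTerm F₀ p φ u v ≤ ENNReal.ofReal 2 * (ENNReal.ofReal F₀ ^ 2 *
      (ENNReal.ofReal p⁻¹ * weightedNormSq φ v + weightedNormSq (fun _ => 1) u)) := by
  have mv : AEMeasurable (fun x => ‖v x‖) (volume : Measure R3) :=
    (Lp.aestronglyMeasurable v).norm.aemeasurable
  have w1 : ∀ (s : R3 → ℝ) (t : L2 k), weightedNormSq s t =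
      ∫⁻ y, ENNReal.ofReal (‖s y • t y‖ ^ 2) := fun s t => by
    refine lintegral_congr fun y => ?_
    rw [ENNReal.ofReal_pow (norm_nonneg _), ofReal_norm, enorm_smul]
  rw [w1, w1, ← lintegral_const_mul' _ _ ENNReal.ofReal_ne_top]
  have hm : AEMeasurable (fun y => ENNReal.ofReal p⁻¹ * ENNReal.ofReal (‖φ y • v y‖ ^ 2))
      (volume : Measure R3) := by
    simp only [norm_smul]
    have := hφ.measurable
    fun_prop
  rw [← lintegral_add_left' hm, ← ENNReal.ofReal_pow hF,
    ← lintegral_const_mul' _ _ ENNReal.ofReal_ne_top,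
    ← lintegral_const_mul' _ _ ENNReal.ofReal_ne_top]
  refine lintegral_mono fun y => ?_
  have ip : 0 < p⁻¹ := inv_pos.2 hp
  simp only [one_smul]
  rw [← ENNReal.ofReal_mul ip.le, ← ENNReal.ofReal_add (by positivity) (by positivity),
    ← ENNReal.ofReal_mul (by positivity), ← ENNReal.ofReal_mul (by positivity)]
  refine ENNReal.ofReal_le_ofReal ?_
  have e : ((√p)⁻¹ * ‖φ y • v y‖) ^ 2 = p⁻¹ * ‖φ y • v y‖ ^ 2 := by
    rw [mul_pow, inv_pow, Real.sq_sqrt hp.le]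
  rw [← e, mul_left_comm]
  refine mul_le_mul_of_nonneg_left ?_ (sq_nonneg _)
  nlinarith [sq_nonneg (‖u y‖ - (√p)⁻¹ * ‖φ y • v y‖)]


/-! ### Tempered scales and the choice of constants -/

theorem shift_pos {ε : ℝ} (hε : 0 < ε) {ℓ : R3 → ℝ} (hℓ : IsTempered ε ℓ) (y : R3) :
    0 < shift ε ℓ y := by
  have := hℓ.1 y
  unfold shift
  positivity

/-- The shift is slowly varying. -/
theorem shift_le_of_le {ε : ℝ} (hε : 0 < ε) {ℓ : R3 → ℝ} (hℓ : IsTempered ε ℓ) {x y : R3}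
    (h : ‖x - y‖ ≤ ε⁻¹ * ℓ x) :
    shift ε ℓ y ≤ 4 * shift ε ℓ x ∧ shift ε ℓ x ≤ 4 * shift ε ℓ y := by
  have hx := hℓ.1 x
  have hy := hℓ.1 y
  obtain ⟨h1, h2⟩ := hℓ.2 x y h
  rw [le_div_iff₀ hx] at h1
  rw [div_le_iff₀ hx] at h2
  have inv : ∀ s t : ℝ, 0 < s → 0 < t → s ≤ 2 * t → (t ^ 2)⁻¹ ≤ 4 * (s ^ 2)⁻¹ := by
    intro s t hs ht hst
    rw [← div_eq_mul_inv, le_div_iff₀ (by positivity), inv_mul_le_iff₀ (by positivity)]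
    nlinarith
  have e5 : 0 < (ε ^ 5)⁻¹ := by positivity
  constructor
  · have := mul_le_mul_of_nonneg_left (inv _ _ hx hy (by linarith)) e5.le
    unfold shift
    linarith
  · have := mul_le_mul_of_nonneg_left (inv _ _ hy hx h2) e5.le
    unfold shift
    linarith

theorem isPotential_shift {ε : ℝ} (hε : 0 < ε) {ℓ : R3 → ℝ} (mℓ : Measurable ℓ)
    (hℓ : IsTempered ε ℓ) : IsPotential (shift ε ℓ) where
  measurable := by
    unfold shift
    fun_prop
  nonneg y := (shift_pos hε hℓ y).le
  locally_bounded K hK := by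
    -- ℓ need not be continuous; local boundedness of P comes from temperedness on a neighbourhood
    -- of each point and compactness.
    refine hK.induction_on (p := fun s => ∃ B, ∀ x ∈ s, shift ε ℓ x ≤ B) ⟨0, by simp⟩ ?_ ?_ ?_
    · rintro s t hst ⟨B, hB⟩
      exact ⟨B, fun x hx => hB x (hst hx)⟩
    · rintro s t ⟨B, hB⟩ ⟨B', hB'⟩
      refine ⟨max B B', fun x hx => ?_⟩
      rcases hx with hx | hx
      · exact (hB x hx).trans (le_max_left _ _)
      · exact (hB' x hx).trans (le_max_right _ _)
    · intro x _
      have := hℓ.1 x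
      refine ⟨closedBall x (ε⁻¹ * ℓ x), mem_nhdsWithin_of_mem_nhds
        (closedBall_mem_nhds x (by positivity)), 4 * shift ε ℓ x, fun y hy => ?_⟩
      refine (shift_le_of_le hε hℓ ?_).1
      rwa [mem_closedBall, dist_comm, dist_eq_norm] at hy

/-- Bound of a commutator by the shift. -/
theorem norm_symb_sq_le {ε : ℝ} (hε : 0 < ε) {ℓ : R3 → ℝ} (hℓ : IsTempered ε ℓ) {x y : R3}
    (h : ‖x - y‖ ≤ ε⁻¹ * ℓ x) {a : FirstOrder k} {c₀ C : ℝ} (ha : ‖a.princ y‖ ≤ c₀) {η : R3 → ℝ}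
    (hη : ‖fderiv ℝ η y‖ ≤ C * (ℓ x)⁻¹) :
    ‖a.symb η y‖ ^ 2 ≤ 36 * c₀ ^ 2 * C ^ 2 * ε ^ 5 * shift ε ℓ y := by
  have h1 := pow_le_pow_left₀ (norm_nonneg _) (a.norm_symb_le ha hη) 2
  have h2 := (shift_le_of_le hε hℓ h).2
  have e1 : ∀ z, ε ^ 5 * shift ε ℓ z = (ℓ z ^ 2)⁻¹ := fun z => by
    rw [shift, ← mul_assoc, mul_inv_cancel₀ (by positivity), one_mul]
  -- The power ε⁵ appears because ℓ⁻² = ε⁵P. The factor 36 is 3² from the three coordinates times 4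
  -- from moving P from `x` to `y`.
  calc ‖a.symb η y‖ ^ 2 ≤ 9 * c₀ ^ 2 * C ^ 2 * (ε ^ 5 * shift ε ℓ x) := by
        rw [e1, ← inv_pow]
        refine h1.trans_eq ?_
        ring
    _ ≤ 9 * c₀ ^ 2 * C ^ 2 * (ε ^ 5 * (4 * shift ε ℓ y)) := by gcongr
    _ = _ := by ring

/-- Fix one ball through `y`: every other ball through `y` meets it, and at most `N` others do. The
1 accounts for the fixed ball. -/
theorem IsUniform.overlap {ι : Type} {N : ℕ} {ℓ : R3 → ℝ} {x : ι → R3} (h : IsUniform N ℓ x)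
    (y : R3) : ∑' i, (closedBall (x i) (10 * ℓ (x i))).indicator (fun _ => (1 : ℝ≥0∞)) y ≤
      N + 1 := by
  set s : Set ι := {i | y ∈ closedBall (x i) (10 * ℓ (x i))} with hs
  have e : ∀ i, (closedBall (x i) (10 * ℓ (x i))).indicator (fun _ => (1 : ℝ≥0∞)) y =
      s.indicator (fun _ => 1) i := fun i => by
    by_cases hi : y ∈ closedBall (x i) (10 * ℓ (x i))
    · rw [indicator_of_mem hi, indicator_of_mem (show i ∈ s from hi)]
    · rw [indicator_of_notMem hi, indicator_of_notMem (show i ∉ s from hi)]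
  rw [tsum_congr e, ← tsum_subtype, ENNReal.tsum_set_one]
  rcases s.eq_empty_or_nonempty with h0 | ⟨j, hj⟩
  · simp [h0]
  have hsub : s ⊆ insert j {i | i ≠ j ∧ (closedBall (x i) (10 * ℓ (x i)) ∩
      closedBall (x j) (10 * ℓ (x j))).Nonempty} := fun i hi => by
    by_cases hij : i = j
    · exact Or.inl hij
    · exact Or.inr ⟨hij, y, hi, hj⟩
  have hcard : s.encard ≤ (N : ℕ∞) + 1 :=
    (encard_le_encard hsub).trans ((encard_insert_le _ _).trans (add_le_add (h.2 j) le_rfl))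
  have := ENat.toENNReal_le.2 hcard
  simpa using this

theorem isLocalization_of_isCutoff {ι : Type} {N : ℕ} {C : ℝ} {ℓ : R3 → ℝ} (hℓ : ∀ y, 0 < ℓ y)
    {x : ι → R3} (hx : IsUniform N ℓ x) {θ χ φ : ι → R3 → ℝ} (h : IsCutoff C ℓ x θ χ φ) :
    IsLocalization N (fun i => closedBall (x i) (10 * ℓ (x i))) θ where
  smooth := h.smooth_θ
  compact i := (isCompact_closedBall (x i) (ℓ (x i))).of_isClosed_subset (isClosed_tsupport _)
    (h.supp_θ i)
  supp i := (h.supp_θ i).trans (closedBall_subset_closedBall (by linarith [hℓ (x i)]))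
  hasSum := h.sum_θ
  measurableSet _ := measurableSet_closedBall
  overlap := hx.overlap

end PullIn

open PullIn in
theorem proposition6p1 (N : ℕ) (C : ℝ) :
    ∃ c : ℝ, 0 < c ∧ ∀ c₀ : ℝ, ∃ ε₀ : ℝ, 0 < ε₀ ∧
      ∀ ε : ℝ, 0 < ε → ε ≤ ε₀ →
      ∀ (k : ℕ), 1 ≤ k →
      -- the length scale and the weight
      ∀ ℓ F : PullIn.R3 → ℝ, Measurable ℓ → PullIn.IsTempered ε ℓ →
      Measurable F → (∀ x, 0 < F x) →
      (∀ x y, ‖x - y‖ ≤ ε⁻¹ * ℓ x → 1 / 2 ≤ F x / F y ∧ F x / F y ≤ 2) →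
      -- the operator
      ∀ A : PullIn.FirstOrder k, (∀ x, ‖A.princ x‖ ≤ c₀) →
      -- the covering and the cutoff functions
      ∀ (ι : Type) [Countable ι] (x : ι → PullIn.R3), PullIn.IsUniform N ℓ x →
      ∀ θ χ φ : ι → PullIn.R3 → ℝ, PullIn.IsCutoff C ℓ x θ χ φ →
      -- the local operators
      ∀ Aloc : ι → PullIn.FirstOrder k,
      (∀ i, ∀ y ∈ tsupport (χ i),
        (Aloc i).princ y = A.princ y ∧ (Aloc i).pot y = A.pot y) →
      ∀ μ : ℝ, 0 ≤ μ →
      let P := PullIn.shift ε ℓ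
      let S := PullIn.opPlus A (fun y => P y + μ)
      let Sloc := fun i => PullIn.opPlus (Aloc i) (fun _ => P (x i))
      -- the operators are self-adjoint and injective, so that the inverses make sense
      (IsSelfAdjoint S ∧ S.toFun.ker = ⊥ ∧
        ((∃ δ : ℝ, 0 < δ ∧ ∀ y, δ ≤ P y + μ) → S.inverse.domain = ⊤)) ∧
      (∀ i, IsSelfAdjoint (Sloc i) ∧ (Sloc i).toFun.ker = ⊥ ∧ (Sloc i).inverse.domain = ⊤) ∧
      -- the inequality between the quadratic forms
      ∀ f : S.inverse.domain,
        PullIn.weightedNormSq F (S.inverse f) ≤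
          ENNReal.ofReal c * ∑' i,
            (⨆ y ∈ Metric.closedBall (x i) (10 * ℓ (x i)), ENNReal.ofReal (F y)) ^ 2 *
            (let u := PullIn.val (Sloc i).inverse
                (PullIn.val (PullIn.mul k fun y => θ i y ^ 2) f)
             ENNReal.ofReal ((P (x i))⁻¹) *
                PullIn.weightedNormSq (φ i) (PullIn.val (Aloc i).op u) +
              PullIn.weightedNormSq (fun _ => 1) u) := by
  obtain ⟨D, hD, cutoff⟩ := exists_cutoff
  -- Twice the factor 40000000(N+1) from `LocalData.estimate`; the 2 is from (s+t)² ≤ 2s² + 2t² in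
  -- `localTerm_le`. The constant `C` only affects ε₀.
  refine ⟨80000000 * (N + 1), by positivity, fun c₀ => ?_⟩
  set Q : ℝ := 100000 * (1 + c₀ ^ 2) * (1 + C ^ 2 + D ^ 2) * (N + 1) with hQ
  have Q0 : 0 < Q := by positivity
  -- ε ≤ 1/10 puts the balls of radius 10ℓᵢ inside the region of slow variation. ε ≤ 1/Q makes the
  -- commutators with θᵢ and hᵢ small relative to P, using ε⁵ ≤ ε.
  refine ⟨min (1 / 10) (1 / Q), by positivity, ?_⟩
  intro ε hε hε₀ k _ ℓ F mℓ hℓ mF hF hFr A hA ι _ x hx θ χ φ hc Aloc hloc μ hμ P S Sloc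
  have hε1 : ε ≤ 1 / 10 := hε₀.trans (min_le_left _ _)
  have hεQ : ε ^ 5 * Q ≤ 1 := by
    have h1 : ε * Q ≤ 1 := (le_div_iff₀ Q0).1 (hε₀.trans (min_le_right _ _))
    have h2 : ε ^ 5 ≤ ε := pow_le_of_le_one hε.le (by linarith) (by norm_num)
    exact (mul_le_mul_of_nonneg_right h2 Q0.le).trans h1
  have hP : IsPotential P := isPotential_shift hε mℓ hℓ
  have P0 : ∀ y, 0 < P y := shift_pos hε hℓ
  have hPμ : IsPotential fun y => P y + μ := hP.add_const hμ
  have Pμ0 : ∀ y, 0 < P y + μ := fun y => add_pos_of_pos_of_nonneg (P0 y) hμ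
  have hPi : ∀ i, IsPotential fun _ : R3 => P (x i) := fun i =>
    ⟨measurable_const, fun _ => (P0 _).le, fun _ _ => ⟨P (x i), fun _ _ => le_rfl⟩⟩
  have domi : ∀ i, (Sloc i).inverse.domain = ⊤ := fun i =>
    opPlus_inverse_domain (Aloc i) (hPi i) (P0 (x i)) fun _ => le_rfl
  refine ⟨⟨isSelfAdjoint_opPlus A hPμ, ker_opPlus A hPμ Pμ0, ?_⟩, fun i =>
    ⟨isSelfAdjoint_opPlus _ (hPi i), ker_opPlus _ (hPi i) fun _ => P0 _, domi i⟩, ?_⟩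
  · rintro ⟨δ, hδ, h⟩
    exact opPlus_inverse_domain A hPμ hδ h
  intro f
  have hdist : ∀ i, ∀ y ∈ closedBall (x i) (10 * ℓ (x i)), ‖x i - y‖ ≤ ε⁻¹ * ℓ (x i) := by
    intro i y hy
    rw [mem_closedBall, dist_comm, dist_eq_norm] at hy
    refine hy.trans (mul_le_mul_of_nonneg_right ?_ (hℓ.1 _).le)
    rw [le_inv_comm₀ (by norm_num) hε]
    linarith
  have hθ := isLocalization_of_isCutoff hℓ.1 hx hc
  choose h smooth_h compact_h range_h one_h supp_h grad_h anis_h using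
    fun i => cutoff (x i) (ℓ (x i)) (hℓ.1 _)
  have H : LocalData A P F N (fun i => closedBall (x i) (10 * ℓ (x i))) x θ h φ Aloc
      (36 * c₀ ^ 2 * C ^ 2 * ε ^ 5) :=
    { potential := hP
      pos := P0
      measurable_F := mF
      pos_F := hF
      loc := hθ
      κ_nonneg := by positivity
      κ_small := by
        have h1 : 73728 * (c₀ ^ 2 * C ^ 2 * (N + 1)) ≤ Q := by
          have h2 : c₀ ^ 2 * C ^ 2 ≤ (1 + c₀ ^ 2) * (1 + C ^ 2 + D ^ 2) :=
            mul_le_mul (by linarith) (by linarith [sq_nonneg D]) (sq_nonneg _) (by positivity)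
          have h3 : c₀ ^ 2 * C ^ 2 * (N + 1) ≤ (1 + c₀ ^ 2) * (1 + C ^ 2 + D ^ 2) * (N + 1) :=
            mul_le_mul_of_nonneg_right h2 (by positivity)
          have h4 : 0 ≤ (1 + c₀ ^ 2) * (1 + C ^ 2 + D ^ 2) * ((N : ℝ) + 1) := by positivity
          rw [hQ]
          linarith
        have h5 := mul_le_mul_of_nonneg_left h1 (by positivity : 0 ≤ ε ^ 5)
        linarith
      symb_θ := fun i y hy => norm_symb_sq_le hε hℓ (hdist i y hy) (hA y) (hc.grad_θ i y)
      P_le := fun i y hy => (shift_le_of_le hε hℓ (hdist i y hy)).1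
      le_P := fun i y hy => (shift_le_of_le hε hℓ (hdist i y hy)).2
      F_le := fun i y hy => by
        have := (hFr _ _ (hdist i y hy)).1
        rw [le_div_iff₀ (hF y)] at this
        linarith
      le_F := fun i y hy => by
        have := (hFr _ _ (hdist i y hy)).2
        rwa [div_le_iff₀ (hF y)] at this
      smooth_h := smooth_h
      compact_h := compact_h
      range_h := range_h
      supp_h := fun i => (supp_h i).trans
        (closedBall_subset_closedBall (by linarith [hℓ.1 (x i)]))
      h_eq_one := fun i y hy => one_h i y (hc.supp_θ i (subset_tsupport _ hy))
      symb_h := fun i y hy => by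
        refine (norm_symb_sq_le hε hℓ (hdist i y hy) (hA y) (grad_h i y)).trans ?_
        have h1 : 36 * (c₀ ^ 2 * D ^ 2) ≤ Q := by
          have h2 : c₀ ^ 2 * D ^ 2 ≤ (1 + c₀ ^ 2) * (1 + C ^ 2 + D ^ 2) :=
            mul_le_mul (by linarith) (by linarith [sq_nonneg C]) (sq_nonneg _) (by positivity)
          have h4 : 0 ≤ (1 + c₀ ^ 2) * (1 + C ^ 2 + D ^ 2) := by positivity
          have h5 : (1 + c₀ ^ 2) * (1 + C ^ 2 + D ^ 2) ≤
              (1 + c₀ ^ 2) * (1 + C ^ 2 + D ^ 2) * ((N : ℝ) + 1) :=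
            le_mul_of_one_le_right h4 (by linarith [(N.cast_nonneg : (0 : ℝ) ≤ N)])
          rw [hQ]
          linarith
        have h5 := mul_le_mul_of_nonneg_left h1 (by positivity : 0 ≤ ε ^ 5)
        refine mul_le_of_le_one_left (P0 y).le ?_
        linarith
      φ_eq_one := fun i y hy => hc.eq_one_φ i y (anis_h i y hy)
      continuous_φ := fun i => (hc.smooth_φ i).continuous
      coeff := fun i y hy => hloc i y <| subset_tsupport _ <| by
        rw [Function.mem_support, hc.eq_one_χ i y (supp_h i hy)]
        exact one_ne_zero }
  obtain ⟨w₀, h₀⟩ := (mem_opPlus_inverse_graph hPμ Pμ0).1 (S.inverse.mem_graph f)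
  choose Λ hΛ using fun i => exists_mulOp_real (k := k) (fun y => θ i y ^ 2)
    ((hc.smooth_θ i).pow 2).continuous
    ((hθ.compact i).comp_left (g := fun t : ℝ => t ^ 2) (by simp))
  have hmul : ∀ i, val (mul k fun y => θ i y ^ 2) f = Λ i f := fun i =>
    val_eq_of_mem_graph (by rw [mul_graph]; exact hΛ i f)
  have hsol : ∀ i, ∃ u v, val (Sloc i).inverse (Λ i f) = u ∧ val (Aloc i).op u = v ∧
      IsWeakSol (Aloc i) (fun _ => P (x i)) u v (Λ i f) := by
    intro i
    have hd : (Λ i f : L2 k) ∈ (Sloc i).inverse.domain := by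
      rw [domi i]
      trivial
    have hg := (Sloc i).inverse.mem_graph ⟨Λ i f, hd⟩
    obtain ⟨v, hv⟩ := (mem_opPlus_inverse_graph (hPi i) fun _ => P0 _).1 hg
    exact ⟨_, v, val_eq_of_mem_graph hg, val_eq_of_mem_graph (by
      rw [(Aloc i).op_graph]
      exact hv.1), hv⟩
  choose u v hu hv hsol using hsol
  have key := H.estimate hμ h₀ hsol fun i => hΛ i f
  have hL : weightedNormSq F (S.inverse f) =
      ∫⁻ y, ENNReal.ofReal (F y ^ 2 * ‖(S.inverse f : L2 k) y‖ ^ 2) := by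
    refine lintegral_congr fun y => ?_
    rw [← mul_pow, ENNReal.ofReal_pow (by have := hF y; positivity), ENNReal.ofReal_mul (hF y).le,
      ofReal_norm, ← ofReal_norm (F y), Real.norm_of_nonneg (hF y).le]
  rw [hL]
  refine key.trans ?_
  have hc2 : ENNReal.ofReal (80000000 * ((N : ℝ) + 1)) =
      ENNReal.ofReal (40000000 * (N + 1)) * ENNReal.ofReal 2 := by
    rw [← ENNReal.ofReal_mul (by positivity)]
    congr 1
    ring
  rw [hc2, mul_assoc]
  refine mul_le_mul_right ?_ _
  rw [← ENNReal.tsum_mul_left]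
  refine ENNReal.tsum_le_tsum fun i => ?_
  simp only
  rw [hmul, hu, hv]
  refine (localTerm_le (hF _).le (P0 _) (H.continuous_φ i) _ _).trans ?_
  refine mul_le_mul_right (mul_le_mul_left (pow_le_pow_left' ?_ 2) _) _
  -- Only the value at the centre is needed, and it is below the supremum defining Fᵢ.
  exact le_iSup₂_of_le (x i) (mem_closedBall_self (by linarith [hℓ.1 (x i)])) le_rfl
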